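/- A global function is a map $f:\{0,1\}^n\to\{0,1\}^n$. It is conjunctive if for every $v$ there is a set $I_v\subseteq\{1,\dots,n\}$ such that $f_v(x)=0$ if and only if $x_u=0$ for some $u\in I_v$. Its interaction digraph $D^f$ has vertex set $\{1,\dots,n\}$ and an arc $(u,v)$ whenever flipping the coordinate $u$ of some configuration $x$ changes $f_v(x)$. For $k\ge 2$, a limit cycle of length $k$ of $f$ (updated in parallel) is a tuple $(x^0,\dots,x^{k-1})$ of pairwise distinct configurations with $f(x^i)=x^{(i+1)\bmod k}$ for all $i$, and $\Phi_k(f)$ is the set of the configurations that lie in such a cycle. A conjunctive $f$ is given as input by the adjacency matrix of $D^f$, encoded in $n^2$ bits. The problem PLCE asks, given a conjunctive global function $f$ and an integer $k\ge 2$ written in binary, whether $\Phi_k(f)\neq\emptyset$; for a fixed $k\ge2$, the problem $k$-PLCE asks the same, given $f$ only. Theorem. Restricted to conjunctive global functions $f$ whose interaction digraph $D^f$ is strongly connected, the problem PLCE is in $\mathrm P$, and so is the problem $k$-PLCE for every fixed $k\ge2$: the language of the encodings of those instances for which $D^f$ is strongly connected and $\Phi_k(f)\neq\emptyset$ is decided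 by a polynomial-time Turing machine. Moreover, for such $f$ and $k\geq 2$, $\Phi_k(f)\neq\emptyset$ if and only if $k$ divides the index of cyclicity of $D^f$, that is, the greatest common divisor of the lengths of the cycles of $D^f$ (or $1$ if $D^f$ has no cycle). -/

import Mathlib

/-- Configurations in `{0,1}^n`. -/
abbrev Config (n : ℕ) : Type := Fin n → Bool

/-- Global functions `f : {0,1}^n → {0,1}^n` of Boolean networks of size `n`; the local function
of the component `v` is `fun x => f x v`. Under the parallel update schedule the dynamics is `f`. -/
abbrev GlobalFunction (n : ℕ) : Type := Config n → Config n

/-- Every local function is the conjunction of the coordinates in some set `I`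
(the constant `1` if `I` is empty). -/
def GlobalFunction.IsConjunctive {n : ℕ} (f : GlobalFunction n) : Prop :=
  ∀ v : Fin n, ∃ I : Set (Fin n), ∀ x : Config n, f x v = false ↔ ∃ u ∈ I, x u = false

/-- The interaction digraph: there is an arc from `u` to `v` iff flipping the coordinate `u` of
some configuration changes the value of the local function of `v`. -/
def GlobalFunction.interactionDigraph {n : ℕ} (f : GlobalFunction n) : Digraph (Fin n) where
  Adj u v := ∃ x : Config n, f x v ≠ f (Function.update x u (!x u)) v

/-- `(c 0, …, c (k-1))` is a limit cycle of length `k > 1` of the dynamics `f`: the configurations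
are pairwise distinct and `f` maps each one to the next, cyclically. -/
def GlobalFunction.IsLimitCycle {n k : ℕ} (f : GlobalFunction n) (c : Fin k → Config n) : Prop :=
  1 < k ∧ Function.Injective c ∧
    ∀ i : Fin k, f (c i) = c ⟨((i : ℕ) + 1) % k, Nat.mod_lt _ i.pos⟩

/-- The set `Φ_k(f)` of the configurations that lie in a limit cycle of length `k` of `f`. -/
def GlobalFunction.limitCycleConfigs {n : ℕ} (k : ℕ) (f : GlobalFunction n) : Set (Config n) :=
  {x | ∃ c : Fin k → Config n, f.IsLimitCycle c ∧ x ∈ Set.range c}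

/-- There is a directed path, possibly of length `0`, from every vertex to every vertex. -/
def Digraph.IsStronglyConnected {V : Type*} (D : Digraph V) : Prop :=
  ∀ u v : V, Relation.ReflTransGen D.Adj u v

/-- `D` has a directed cycle of length `m ≥ 1`, through `m` distinct vertices
(a loop is a cycle of length `1`). -/
def Digraph.HasCycleOfLength {V : Type*} (D : Digraph V) (m : ℕ) : Prop :=
  0 < m ∧ ∃ c : Fin m → V, Function.Injective c ∧
    ∀ i : Fin m, D.Adj (c i) (c ⟨((i : ℕ) + 1) % m, Nat.mod_lt _ i.pos⟩)

open scoped Classical in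
/-- The index of cyclicity of a strongly connected digraph on `n` vertices: the greatest common
divisor of the lengths of its cycles (which are at most `n`), or `1` if it has no cycle. -/
noncomputable def Digraph.cyclicityIndex {n : ℕ} (D : Digraph (Fin n)) : ℕ :=
  if ∃ m, D.HasCycleOfLength m then
    ((Finset.Icc 1 n).filter fun m => D.HasCycleOfLength m).gcd id
  else 1

open scoped Classical in
/-- The adjacency matrix, row by row, as a word of `n ^ 2` bits. -/
noncomputable def Digraph.adjacencyBits {n : ℕ} (D : Digraph (Fin n)) : List Bool :=
  (List.finRange n).flatMap fun u => (List.finRange n).map fun v => decide (D.Adj u v)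

/-- An instance `(f, k)` of the PLCE problem as a word: the adjacency matrix of the interaction
digraph, written with the symbols `inl b`, followed by `k` in binary, written with the symbols
`inr b`. -/
noncomputable def encodePLCE {n : ℕ} (f : GlobalFunction n) (k : ℕ) : List (Bool ⊕ Bool) :=
  f.interactionDigraph.adjacencyBits.map Sum.inl ++ (Computability.encodeNat k).map Sum.inr

/-- The language of the PLCE problem restricted to conjunctive networks whose interaction digraph
is strongly connected: the words that encode an instance `(f, k)` of this kind
with `Φ_k(f) ≠ ∅`. -/
def stronglyConnectedPLCE : Language (Bool ⊕ Bool) :=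
  {w | ∃ (n k : ℕ) (f : GlobalFunction n), 2 ≤ k ∧ f.IsConjunctive ∧
    f.interactionDigraph.IsStronglyConnected ∧ (f.limitCycleConfigs k).Nonempty ∧
    w = encodePLCE f k}

/-- The language of the `k`-PLCE problem (`k` is fixed and not part of the input) with the same
restriction; the input is the adjacency matrix of the interaction digraph. -/
def stronglyConnectedKPLCE (k : ℕ) : Language Bool :=
  {w | ∃ (n : ℕ) (f : GlobalFunction n), f.IsConjunctive ∧
    f.interactionDigraph.IsStronglyConnected ∧ (f.limitCycleConfigs k).Nonempty ∧
    w = f.interactionDigraph.adjacencyBits}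

open scoped Classical in
/-- The class P: some multi-stack Turing machine decides, for every word `w` over the input
alphabet, whether `w` belongs to `L`, and halts within `p(|w|)` steps for a fixed polynomial `p`. -/
def InP {Γ : Type} (L : Language Γ) : Prop :=
  Nonempty (Turing.TM2ComputableInPolyTime (id : List Γ → List Γ) Computability.encodeBool
    fun w => decide (w ∈ L))

/-! In a conjunctive network a component becomes 0 exactly when one of its in-neighbours is 0, so
after $t$ steps the zeros are the ends of the walks of length $t$ that start in a zero
(`IsConjunctive.iterate_eq_false_iff`). Let $D^f$ be strongly connected. On an orbit of period $k$,
a closed walk of length $L$ through $v$ carries a zero of $v$ from time $i$ to time $i+L$. Going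
round $k$ times leads back to time $i$ modulo the period, so the values at $v$ also have period $L$.
Through every $v$ there are closed walks that differ by one turn of a given cycle of length $m$.
Hence $m$ is a period of the orbit and $k\mid m$ (`IsLimitCycle.dvd_cyclicityIndex`). Conversely, if
$k$ divides the lengths of all cycles, it divides those of all closed walks
(`Walk.dvd_of_forall_cycle`), so the length modulo $k$ of a walk from a root to $v$ depends on $v$
only. The configurations that vanish on exactly one of these $k$ cyclic classes form a limit cycle
(`IsConjunctive.exists_limitCycle`).

For membership in P the criterion becomes a condition on walks no longer than the input
(`walkCondition_iff`), which is tested by propagating a set of vertices along the arcs. The number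
$k$ may be exponential in the length of its encoding, but $k\le n$ in every positive instance, so it
can be read in saturating arithmetic (`eval_decode`, `WalkCondition.not_le`). Words that encode no
instance are recognised as well: the matrix must have square length and precede the digits, and the
most significant digit must be 1.

The algorithm reaches a Turing machine through two translations. It is written in `Cmd`, a language
of counters and bit arrays whose loops run exactly $N$ times, $N$ being the input length. A program
enlarges its data by at most $g(N)$, whatever their size was before (`exists_growth`), so nested
loops keep sizes and running time polynomial (`exists_cost`). A `Cmd` is compiled into a structured
program on stacks, with counters in unary, and this one into a `TM2` machine with the same number of
steps (`Run.steps`). -/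

/-! ### Structured programs on stacks of bits -/

/-- Structured programs acting on finitely many stacks of bits, indexed by `R`, and on a finite
memory `σ`. -/
inductive StackProg (R σ : Type) : Type
  | push (r : R) (f : σ → Bool)
  | pop (r : R) (f : σ → Option Bool → σ)
  | load (f : σ → σ)
  | seq (p q : StackProg R σ)
  | ite (b : σ → Bool) (p q : StackProg R σ)
  | while (b : σ → Bool) (p : StackProg R σ)

namespace StackProg

open Turing

variable {R σ : Type}

/-- `Run p v ρ v' ρ' t`: started with the memory `v` and the stacks `ρ`, the program `p` stops after
`t` steps with the memory `v'` and the stacks `ρ'`. -/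
inductive Run [DecidableEq R] : StackProg R σ → σ → (R → List Bool) → σ → (R → List Bool) → ℕ → Prop
  | push (r f v ρ) : Run (push r f) v ρ v (Function.update ρ r (f v :: ρ r)) 1
  | pop (r f v ρ) : Run (pop r f) v ρ (f v (ρ r).head?) (Function.update ρ r (ρ r).tail) 1
  | load (f v ρ) : Run (load f) v ρ (f v) ρ 1
  | seq {p q v₁ ρ₁ v₂ ρ₂ v₃ ρ₃ t₁ t₂} (h₁ : Run p v₁ ρ₁ v₂ ρ₂ t₁) (h₂ : Run q v₂ ρ₂ v₃ ρ₃ t₂) :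
      Run (seq p q) v₁ ρ₁ v₃ ρ₃ (t₁ + t₂)
  | ite_true {b p q v₁ ρ₁ v₂ ρ₂ t} (hb : b v₁ = true) (h : Run p v₁ ρ₁ v₂ ρ₂ t) :
      Run (ite b p q) v₁ ρ₁ v₂ ρ₂ (1 + t)
  | ite_false {b p q v₁ ρ₁ v₂ ρ₂ t} (hb : b v₁ = false) (h : Run q v₁ ρ₁ v₂ ρ₂ t) :
      Run (ite b p q) v₁ ρ₁ v₂ ρ₂ (1 + t)
  | while_done {b p v ρ} (hb : b v = false) : Run (StackProg.while b p) v ρ v ρ 1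
  | while_step {b p v₁ ρ₁ v₂ ρ₂ v₃ ρ₃ t₁ t₂} (hb : b v₁ = true) (h₁ : Run p v₁ ρ₁ v₂ ρ₂ t₁)
      (h₂ : Run (StackProg.while b p) v₂ ρ₂ v₃ ρ₃ t₂) :
      Run (StackProg.while b p) v₁ ρ₁ v₃ ρ₃ (1 + (t₁ + t₂))

/-- The control locations of a program. -/
def Label : StackProg R σ → Type
  | push _ _ => Unit
  | pop _ _ => Unit
  | load _ => Unit
  | seq p q => p.Label ⊕ q.Label
  | ite _ p q => Option (p.Label ⊕ q.Label)
  | StackProg.while _ p => Option p.Label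

/-- The control locations of a program are finite in number. -/
@[reducible] def fintypeLabel : (p : StackProg R σ) → Fintype p.Label
  | push _ _ => inferInstanceAs (Fintype Unit)
  | pop _ _ => inferInstanceAs (Fintype Unit)
  | load _ => inferInstanceAs (Fintype Unit)
  | seq p q =>
    have := fintypeLabel p
    have := fintypeLabel q
    inferInstanceAs (Fintype (p.Label ⊕ q.Label))
  | ite _ p q =>
    have := fintypeLabel p
    have := fintypeLabel q
    inferInstanceAs (Fintype (Option (p.Label ⊕ q.Label)))
  | StackProg.while _ p =>
    have := fintypeLabel p
    inferInstanceAs (Fintype (Option p.Label))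

instance (p : StackProg R σ) : Fintype p.Label := p.fintypeLabel

/-- The initial control location. -/
def entry : (p : StackProg R σ) → p.Label
  | push _ _ => ()
  | pop _ _ => ()
  | load _ => ()
  | seq p _ => Sum.inl p.entry
  | ite _ _ _ => none
  | StackProg.while _ _ => none

section Steps

variable {L : Type} {K : Type} [DecidableEq K] {Γ : K → Type}

/-- The machine `M` goes from `c` to `c'` in `t` steps. -/
def Steps (M : L → TM2.Stmt Γ L σ) (t : ℕ)
    (c c' : TM2.Cfg Γ L σ) : Prop :=
  (flip bind (TM2.step M))^[t] (some c) = some c'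


theorem Steps.trans {M : L → TM2.Stmt Γ L σ} {t₁ t₂ : ℕ}
    {c₁ c₂ c₃ : TM2.Cfg Γ L σ} (h₁ : Steps M t₁ c₁ c₂) (h₂ : Steps M t₂ c₂ c₃) :
    Steps M (t₁ + t₂) c₁ c₃ := by
  unfold Steps at *
  rw [add_comm, Function.iterate_add_apply, h₁, h₂]


theorem Steps.single {M : L → TM2.Stmt Γ L σ}
    {c c' : TM2.Cfg Γ L σ} (h : TM2.step M c = some c') : Steps M 1 c c' := by
  simpa [Steps, flip] using h

end Steps

/-! ### From structured programs to multi-stack Turing machines. -/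

section Compile

variable {K L : Type}

/-- The stack alphabets of the compiled machine: `Γ₀` on the stacks in `K`, and bits on
the stacks in `R`. -/
abbrev Alphabet (K R : Type) (Γ₀ : Type) : K ⊕ R → Type
  | Sum.inl _ => Γ₀
  | Sum.inr _ => Bool

variable {Γ₀ : Type}

/-- The statement of a Turing machine at a control location of a program, where control locations
are embedded into the labels of the machine by `emb`, and the machine continues at `exit`. -/
def code : (p : StackProg R σ) → (emb : p.Label → L) → (exit : L) → p.Label →
    TM2.Stmt (Alphabet K R Γ₀) L σ
  | push r f, _, exit, _ => .push (Sum.inr r) f (.goto fun _ => exit)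
  | pop r f, _, exit, _ => .pop (Sum.inr r) f (.goto fun _ => exit)
  | load f, _, exit, _ => .load f (.goto fun _ => exit)
  | seq p q, emb, exit, l =>
    match l with
    | Sum.inl l => p.code (fun l => emb (Sum.inl l)) (emb (Sum.inr q.entry)) l
    | Sum.inr l => q.code (fun l => emb (Sum.inr l)) exit l
  | ite b p q, emb, exit, l =>
    match l with
    | none => .branch b (.goto fun _ => emb (some (Sum.inl p.entry)))
        (.goto fun _ => emb (some (Sum.inr q.entry)))
    | some (Sum.inl l) => p.code (fun l => emb (some (Sum.inl l))) exit l
    | some (Sum.inr l) => q.code (fun l => emb (some (Sum.inr l))) exit l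
  | StackProg.while b p, emb, exit, l =>
    match l with
    | none => .branch b (.goto fun _ => emb (some p.entry)) (.goto fun _ => exit)
    | some l => p.code (fun l => emb (some l)) (emb none) l

/-- The stacks of the compiled machine. -/
def stackCfg (κ : K → List Γ₀) (ρ : R → List Bool) : ∀ k, List (Alphabet K R Γ₀ k)
  | Sum.inl k => κ k
  | Sum.inr r => ρ r

variable [DecidableEq K] [DecidableEq R]

theorem update_stackCfg_inr (κ : K → List Γ₀) (ρ : R → List Bool) (r : R) (l : List Bool) :
    Function.update (stackCfg κ ρ) (Sum.inr r) l = stackCfg κ (Function.update ρ r l) := by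
  funext k
  rcases k with k | k
  · simp [stackCfg]
  · by_cases h : k = r
    · subst h; simp [stackCfg]
    · simp [stackCfg, h]

theorem update_stackCfg_inl (κ : K → List Γ₀) (ρ : R → List Bool) (k : K) (l : List Γ₀) :
    Function.update (stackCfg κ ρ) (Sum.inl k) l = stackCfg (Function.update κ k l) ρ := by
  funext k'
  rcases k' with k' | k'
  · by_cases h : k' = k
    · subst h; simp [stackCfg]
    · simp [stackCfg, h]
  · simp [stackCfg]

/-- Induction on the run. The embedding of the labels and the exit are arbitrary because a
subprogram is a part of the same machine, with its own labels and its own continuation; in a further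
round of a `while` both stay the same. -/
theorem Run.steps {p : StackProg R σ} {v v' : σ} {ρ ρ' : R → List Bool} {t : ℕ}
    (h : Run p v ρ v' ρ' t) (κ : K → List Γ₀) (M : L → TM2.Stmt (Alphabet K R Γ₀) L σ)
    (emb : p.Label → L) (exit : L) (hM : ∀ l, M (emb l) = p.code emb exit l) :
    Steps M t ⟨some (emb p.entry), v, stackCfg κ ρ⟩ ⟨some exit, v', stackCfg κ ρ'⟩ := by
  induction h generalizing exit with
  | push r f v ρ =>
    refine Steps.single ?_
    rw [TM2.step, hM]
    simp only [code, TM2.stepAux, ← update_stackCfg_inr]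
    rfl
  | pop r f v ρ =>
    refine Steps.single ?_
    rw [TM2.step, hM]
    simp only [code, TM2.stepAux, ← update_stackCfg_inr]
    rfl
  | load f v ρ =>
    refine Steps.single ?_
    rw [TM2.step, hM]
    simp only [code, TM2.stepAux]
  | seq h₁ h₂ ih₁ ih₂ =>
    exact (ih₁ (fun l => emb (Sum.inl l)) _ fun l => hM (Sum.inl l)).trans
      (ih₂ (fun l => emb (Sum.inr l)) _ fun l => hM (Sum.inr l))
  | ite_true hb h ih =>
    refine Steps.trans (Steps.single ?_)
      (ih (fun l => emb (some (Sum.inl l))) _ fun l => hM (some (Sum.inl l)))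
    rw [TM2.step, hM]
    simp only [entry, code, TM2.stepAux, hb, cond_true]
  | ite_false hb h ih =>
    refine Steps.trans (Steps.single ?_)
      (ih (fun l => emb (some (Sum.inr l))) _ fun l => hM (some (Sum.inr l)))
    rw [TM2.step, hM]
    simp only [entry, code, TM2.stepAux, hb, cond_false]
  | while_done hb =>
    refine Steps.single ?_
    rw [TM2.step, hM]
    simp only [entry, code, TM2.stepAux, hb, cond_false]
  | while_step hb h₁ h₂ ih₁ ih₂ =>
    refine Steps.trans (Steps.single ?_)
      ((ih₁ (fun l => emb (some l)) _ fun l => hM (some l)).trans (ih₂ emb exit hM))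
    rw [TM2.step, hM]
    simp only [entry, code, TM2.stepAux, hb, cond_true]

end Compile

/-! ### Decision procedures -/

/-- The memory of a decision procedure: the last symbol read from the input, the last bits read from
two other stacks, and the result of a test. -/
structure Memory (G : Type) where
  sym : Option G := none
  fst : Option Bool := none
  snd : Option Bool := none
  flag : Bool := false

/-- The memory is a tuple of finite values. -/
def Memory.equiv (G : Type) : Memory G ≃ Option G × Option Bool × Option Bool × Bool where
  toFun v := ⟨v.sym, v.fst, v.snd, v.flag⟩
  invFun v := ⟨v.1, v.2.1, v.2.2.1, v.2.2.2⟩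
  left_inv _ := rfl
  right_inv _ := rfl

instance (G : Type) [Fintype G] : Fintype (Memory G) := Fintype.ofEquiv _ (Memory.equiv G).symm

/-- The control locations of the machine that first distributes its input over stacks of bits and
then runs a program. -/
inductive DeciderLabel {R σ : Type} (p : StackProg R σ)
  | reverse
  | distribute
  | body (l : p.Label)
  | finish

/-- Any control location is a location of the program or one of three others. -/
def DeciderLabel.equiv (p : StackProg R σ) : DeciderLabel p ≃ p.Label ⊕ Fin 3 where
  toFun
    | .reverse => Sum.inr 0
    | .distribute => Sum.inr 1
    | .finish => Sum.inr 2
    | .body l => Sum.inl l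
  invFun
    | Sum.inr 0 => .reverse
    | Sum.inr 1 => .distribute
    | Sum.inr 2 => .finish
    | Sum.inl l => .body l
  left_inv l := by cases l <;> rfl
  right_inv l := by
    rcases l with l | l
    · rfl
    · fin_cases l <;> rfl

instance (p : StackProg R σ) : Fintype (DeciderLabel p) :=
  Fintype.ofEquiv _ (DeciderLabel.equiv p).symm

section Decider

variable {G : Type}

/-- The statements of a machine that reverses its input, puts two bits and a mark for each symbol on
the stacks `r₁`, `r₂` and `len`, and runs the program `p`. -/
def deciderCode [Inhabited G] (p : StackProg R (Memory G)) (f₁ f₂ : G → Bool) (r₁ r₂ len : R) :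
    DeciderLabel p → TM2.Stmt (Alphabet Bool R G) (DeciderLabel p) (Memory G)
  | .reverse => .pop (Sum.inl false) (fun v a => { v with sym := a }) <|
      .branch (fun v => v.sym.isSome)
        (.push (Sum.inl true) (fun v => v.sym.getD default) <| .goto fun _ => .reverse)
        (.goto fun _ => .distribute)
  | .distribute => .pop (Sum.inl true) (fun v a => { v with sym := a }) <|
      .branch (fun v => v.sym.isSome)
        (.push (Sum.inr r₁) (fun v => f₁ (v.sym.getD default)) <|
          .push (Sum.inr r₂) (fun v => f₂ (v.sym.getD default)) <|
          .push (Sum.inr len) (fun _ => true) <| .goto fun _ => .distribute)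
        (.goto fun _ => .body p.entry)
  | .body l => p.code .body .finish l
  | .finish => .load (fun _ => {}) .halt

variable [DecidableEq R]

/-- The stacks of bits after the input `w` has been distributed. -/
def inputStacks (f₁ f₂ : G → Bool) (r₁ r₂ len : R) (w : List G) : R → List Bool := fun r =>
  if r = r₁ then w.map f₁ else if r = r₂ then w.map f₂ else
    if r = len then List.replicate w.length true else []

theorem update_inputStacks {f₁ f₂ : G → Bool} {r₁ r₂ len : R} (h₁ : r₁ ≠ r₂) (h₂ : r₁ ≠ len)
    (h₃ : r₂ ≠ len) (a : G) (w : List G) :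
    Function.update (Function.update (Function.update (inputStacks f₁ f₂ r₁ r₂ len w) r₁
      (f₁ a :: w.map f₁)) r₂ (f₂ a :: w.map f₂)) len (true :: List.replicate w.length true) =
      inputStacks f₁ f₂ r₁ r₂ len (a :: w) := by
  funext r
  simp only [inputStacks, Function.update_apply, List.map_cons, List.length_cons,
    List.replicate_succ]
  split_ifs <;> simp_all

/-- Moving a stack reverses it, and `steps_distribute` reverses it again, so the bits finally lie in
the order of the input. The extra step is the pop that finds the stack empty. -/
theorem steps_reverse [Inhabited G] (p : StackProg R (Memory G)) (f₁ f₂ : G → Bool) (r₁ r₂ len : R)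
    (w u : List G) (v : Memory G) (ρ : R → List Bool) :
    Steps (deciderCode p f₁ f₂ r₁ r₂ len) (w.length + 1)
      ⟨some .reverse, v, stackCfg (fun b => cond b u w) ρ⟩
      ⟨some .distribute, { v with sym := none }, stackCfg (fun b => cond b (w.reverse ++ u) []) ρ⟩ := by
  induction w generalizing u v with
  | nil =>
    refine Steps.single ?_
    simp only [TM2.step, deciderCode, TM2.stepAux, stackCfg, update_stackCfg_inl]
    simp
    congr 1
    funext b; cases b <;> simp
  | cons a w ih =>
    rw [List.length_cons, add_comm]
    refine Steps.trans (Steps.single (c' := ⟨some .reverse, { v with sym := some a },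
      stackCfg (fun b => cond b (a :: u) w) ρ⟩) ?_) (by simpa using ih (a :: u) { v with sym := some a })
    simp only [TM2.step, deciderCode, TM2.stepAux, stackCfg, update_stackCfg_inl]
    simp
    congr 1
    funext b; cases b <;> simp

theorem steps_distribute [Inhabited G] (p : StackProg R (Memory G)) (f₁ f₂ : G → Bool) {r₁ r₂ len : R}
    (h₁ : r₁ ≠ r₂) (h₂ : r₁ ≠ len) (h₃ : r₂ ≠ len) (u w : List G) (v : Memory G) :
    Steps (deciderCode p f₁ f₂ r₁ r₂ len) (u.length + 1)
      ⟨some .distribute, v, stackCfg (fun b => cond b u []) (inputStacks f₁ f₂ r₁ r₂ len w)⟩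
      ⟨some (.body p.entry), { v with sym := none },
        stackCfg (fun _ => []) (inputStacks f₁ f₂ r₁ r₂ len (u.reverse ++ w))⟩ := by
  induction u generalizing w v with
  | nil =>
    refine Steps.single ?_
    simp only [TM2.step, deciderCode, TM2.stepAux, stackCfg, update_stackCfg_inl]
    simp
  | cons a u ih =>
    rw [List.length_cons, add_comm]
    refine Steps.trans (Steps.single (c' := ⟨some .distribute, { v with sym := some a },
      stackCfg (fun b => cond b u []) (inputStacks f₁ f₂ r₁ r₂ len (a :: w))⟩) ?_)
      (by simpa using ih (a :: w) { v with sym := some a })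
    simp only [TM2.step, deciderCode, TM2.stepAux, stackCfg, update_stackCfg_inl]
    simp [update_stackCfg_inr, stackCfg, ← update_inputStacks h₁ h₂ h₃]
    congr 1
    · funext b; cases b <;> simp
    · funext r
      simp [Function.update_apply, h₁.symm, h₂.symm, h₃.symm, inputStacks]

/-- The Turing machine that runs a program on its distributed input. -/
@[reducible] def deciderMachine [Inhabited G] [Fintype R] [Fintype G] (p : StackProg R (Memory G))
    (f₁ f₂ : G → Bool) (r₁ r₂ len out : R) : FinTM2 where
  K := Bool ⊕ R
  k₀ := Sum.inl false
  k₁ := Sum.inr out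
  Γ := Alphabet Bool R G
  Λ := DeciderLabel p
  main := .reverse
  σ := Memory G
  initialState := {}
  m := deciderCode p f₁ f₂ r₁ r₂ len

theorem initList_deciderMachine [Inhabited G] [Fintype R] [Fintype G] (p : StackProg R (Memory G))
    (f₁ f₂ : G → Bool) (r₁ r₂ len out : R) (w : List G) :
    initList (deciderMachine p f₁ f₂ r₁ r₂ len out) w = ⟨some .reverse, {},
      stackCfg (fun b => cond b [] w) (inputStacks f₁ f₂ r₁ r₂ len [])⟩ := by
  refine congrArg (TM2.Cfg.mk _ _) ?_
  funext k
  rcases k with (_ | _) | k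
  · rfl
  · rfl
  · simp [stackCfg, inputStacks]

theorem haltList_deciderMachine [Inhabited G] [Fintype R] [Fintype G] (p : StackProg R (Memory G))
    (f₁ f₂ : G → Bool) (r₁ r₂ len out : R) (w : List Bool) :
    haltList (deciderMachine p f₁ f₂ r₁ r₂ len out) w = ⟨none, {},
      stackCfg (fun _ => []) (Function.update (fun _ => []) out w)⟩ := by
  refine congrArg (TM2.Cfg.mk _ _) ?_
  funext k
  rcases k with k | k
  · rfl
  · by_cases h : k = out
    · subst h
      simp [stackCfg]
    · simp [stackCfg, h]

/-- The halting configuration is prescribed completely: initial memory, and all stacks empty except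
the output. The memory is reset by the label `finish`, but the program itself must leave its stacks
clean. Two passes over the input and the final step account for `2 * X + 3`. -/
theorem inP_of_run [Inhabited G] [Fintype R] [Fintype G] {p : StackProg R (Memory G)} {f₁ f₂ : G → Bool}
    {r₁ r₂ len out : R} (h₁ : r₁ ≠ r₂) (h₂ : r₁ ≠ len) (h₃ : r₂ ≠ len) {L : Language G}
    (T : Polynomial ℕ) (run : ∀ w : List G, ∃ (b : Bool) (v : Memory G) (t : ℕ),
      (b = true ↔ w ∈ L) ∧ t ≤ T.eval w.length ∧
      Run p {} (inputStacks f₁ f₂ r₁ r₂ len w) v (Function.update (fun _ => []) out [b]) t) :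
    InP L := by
  classical
  choose b v t hb ht hrun using run
  refine ⟨⟨⟨deciderMachine p f₁ f₂ r₁ r₂ len out, Equiv.refl _, Equiv.refl _⟩,
    2 * Polynomial.X + 3 + T, fun w => ?_⟩⟩
  have hs : Steps (deciderCode p f₁ f₂ r₁ r₂ len)
      ((w.length + 1) + ((w.reverse.length + 1) + (t w + 1)))
      ⟨some .reverse, {}, stackCfg (fun b => cond b [] w) (inputStacks f₁ f₂ r₁ r₂ len [])⟩
      ⟨none, {}, stackCfg (fun _ => []) (Function.update (fun _ => []) out [b w])⟩ := by
    refine (steps_reverse p f₁ f₂ r₁ r₂ len w [] {} _).trans ?_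
    rw [List.append_nil]
    refine (steps_distribute p f₁ f₂ h₁ h₂ h₃ w.reverse [] _).trans ?_
    rw [List.append_nil, List.reverse_reverse]
    refine ((hrun w).steps _ _ DeciderLabel.body .finish fun l => rfl).trans (Steps.single rfl)
  refine ⟨⟨(w.length + 1) + ((w.reverse.length + 1) + (t w + 1)), ?_⟩, ?_⟩
  · have hd : decide (w ∈ L) = b w := by simp [← hb]
    rw [← initList_deciderMachine p f₁ f₂ r₁ r₂ len out,
      ← haltList_deciderMachine p f₁ f₂ r₁ r₂ len out] at hs
    simp only [Equiv.refl, hd, id_eq]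
    rw [List.map_id w]
    exact hs
  · have := ht w
    simp
    omega

end Decider

end StackProg

/-! ### Runs with upper bounds on the number of steps. -/

namespace StackProg

variable {R σ : Type} [DecidableEq R]

/-- `Exec p v ρ v' ρ' B`: the program `p` leads from `(v, ρ)` to `(v', ρ')` in at most `B` steps. -/
def Exec (p : StackProg R σ) (v : σ) (ρ : R → List Bool) (v' : σ) (ρ' : R → List Bool) (B : ℕ) :
    Prop :=
  ∃ t ≤ B, Run p v ρ v' ρ' t

section Exec

variable {p q : StackProg R σ} {b : σ → Bool} {v v₁ v₂ v₃ : σ} {ρ ρ₁ ρ₂ ρ₃ : R → List Bool}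
  {B B₁ B₂ : ℕ}

theorem Exec.mono (h : Exec p v₁ ρ₁ v₂ ρ₂ B₁) (hB : B₁ ≤ B₂) : Exec p v₁ ρ₁ v₂ ρ₂ B₂ :=
  let ⟨t, ht, h⟩ := h
  ⟨t, ht.trans hB, h⟩

theorem Exec.cast (h : Exec p v₁ ρ₁ v₂ ρ₂ B) (hρ : ρ₂ = ρ₃) : Exec p v₁ ρ₁ v₂ ρ₃ B :=
  hρ ▸ h

theorem Exec.push (r : R) (f : σ → Bool) :
    Exec (push r f) v ρ v (Function.update ρ r (f v :: ρ r)) 1 :=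
  ⟨1, le_rfl, .push _ _ _ _⟩

theorem Exec.pop (r : R) (f : σ → Option Bool → σ) :
    Exec (pop r f) v ρ (f v (ρ r).head?) (Function.update ρ r (ρ r).tail) 1 :=
  ⟨1, le_rfl, .pop _ _ _ _⟩

theorem Exec.load (f : σ → σ) : Exec (load f) v ρ (f v) ρ 1 :=
  ⟨1, le_rfl, .load _ _ _⟩

theorem Exec.seq (h₁ : Exec p v₁ ρ₁ v₂ ρ₂ B₁) (h₂ : Exec q v₂ ρ₂ v₃ ρ₃ B₂) :
    Exec (seq p q) v₁ ρ₁ v₃ ρ₃ (B₁ + B₂) :=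
  let ⟨_, ht₁, h₁⟩ := h₁
  let ⟨_, ht₂, h₂⟩ := h₂
  ⟨_, add_le_add ht₁ ht₂, .seq h₁ h₂⟩

/-- Sequential composition is associative, up to the steps it takes. -/
theorem Exec.assoc {p' : StackProg R σ} (h₁ : Exec (.seq p p') v₁ ρ₁ v₂ ρ₂ B₁)
    (h₂ : Exec q v₂ ρ₂ v₃ ρ₃ B₂) : Exec (.seq p (.seq p' q)) v₁ ρ₁ v₃ ρ₃ (B₁ + B₂) := by
  obtain ⟨_, ht₁, h₁⟩ := h₁
  obtain ⟨_, ht₂, h₂⟩ := h₂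
  cases h₁ with
  | seq h h' => exact ⟨_, by omega, .seq h (.seq h' h₂)⟩

theorem Exec.ite_true (hb : b v₁ = true) (h : Exec p v₁ ρ₁ v₂ ρ₂ B) :
    Exec (ite b p q) v₁ ρ₁ v₂ ρ₂ (1 + B) :=
  let ⟨_, ht, h⟩ := h
  ⟨_, Nat.add_le_add_left ht _, .ite_true hb h⟩

theorem Exec.ite_false (hb : b v₁ = false) (h : Exec q v₁ ρ₁ v₂ ρ₂ B) :
    Exec (ite b p q) v₁ ρ₁ v₂ ρ₂ (1 + B) :=
  let ⟨_, ht, h⟩ := h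
  ⟨_, Nat.add_le_add_left ht _, .ite_false hb h⟩

theorem Exec.while_done (hb : b v = false) : Exec (StackProg.while b p) v ρ v ρ 1 :=
  ⟨1, le_rfl, .while_done hb⟩

theorem Exec.while_step (hb : b v₁ = true) (h₁ : Exec p v₁ ρ₁ v₂ ρ₂ B₁)
    (h₂ : Exec (StackProg.while b p) v₂ ρ₂ v₃ ρ₃ B₂) :
    Exec (StackProg.while b p) v₁ ρ₁ v₃ ρ₃ (1 + (B₁ + B₂)) :=
  let ⟨_, ht₁, h₁⟩ := h₁
  let ⟨_, ht₂, h₂⟩ := h₂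
  ⟨_, Nat.add_le_add_left (add_le_add ht₁ ht₂) _, .while_step hb h₁ h₂⟩

end Exec

/-! ### Elementary programs -/

variable {G : Type}

/-- Pop a bit into the first field of the memory. -/
def popFst (r : R) : StackProg R (Memory G) := pop r fun v a => { v with fst := a }

/-- Pop a bit into the second field of the memory. -/
def popSnd (r : R) : StackProg R (Memory G) := pop r fun v a => { v with snd := a }

/-- Push the bit in the first field of the memory. -/
def pushFst (r : R) : StackProg R (Memory G) := push r fun v => v.fst.getD false

/-- Push the bit in the second field of the memory. -/
def pushSnd (r : R) : StackProg R (Memory G) := push r fun v => v.snd.getD false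

/-- Iterate a program over the bits of a stack, which is emptied. -/
def forEach (r : R) (p : StackProg R (Memory G)) : StackProg R (Memory G) :=
  seq (popFst r) (StackProg.while (fun v => v.fst.isSome) (seq p (popFst r)))

/-- Empty a stack. -/
def clear (r : R) : StackProg R (Memory G) := forEach r (load id)

/-- Move a stack on top of another one. -/
def move (r r₁ : R) : StackProg R (Memory G) := forEach r (pushFst r₁)

/-- Move a stack on top of two others. -/
def move₂ (r r₁ r₂ : R) : StackProg R (Memory G) := forEach r (seq (pushFst r₁) (pushFst r₂))

/-- Move bits from the stack `a` to the stack `buf`, as many as there are on the stack `x`, which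
is moved to `tmp`. -/
def seek (x a tmp buf : R) : StackProg R (Memory G) :=
  forEach x (seq (pushFst tmp) (seq (popSnd a)
    (ite (fun v => v.snd.isSome) (pushSnd buf) (load id))))

variable {v : Memory G} {ρ : R → List Bool}

/-- The invariant `P l` speaks of the bits `l` still to be treated; the first of them is already in
the memory and only the tail is on the stack. Each bit costs the test, the body and a pop, hence `B
+ 2`; the first pop and the last test give the final `2`. -/
theorem exec_forEach {r : R} {p : StackProg R (Memory G)} {v : Memory G} {ρ : R → List Bool}
    {l : List Bool} (hl : ρ r = l) {B : ℕ}
    (P : List Bool → Memory G → (R → List Bool) → Prop)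
    (h₀ : P l { v with fst := l.head? } (Function.update ρ r l.tail))
    (h : ∀ b l v ρ, P (b :: l) v ρ → v.fst = some b → ρ r = l → ∃ v' ρ', Exec p v ρ v' ρ' B ∧
      ρ' r = l ∧ P l { v' with fst := l.head? } (Function.update ρ' r l.tail)) :
    ∃ v' ρ', Exec (forEach r p) v ρ v' ρ' ((B + 2) * l.length + 2) ∧ P [] v' ρ' ∧ v'.fst = none ∧
      ρ' r = [] := by
  have key : ∀ (l : List Bool) (v : Memory G) (ρ : R → List Bool), P l v ρ → v.fst = l.head? →
      ρ r = l.tail → ∃ v' ρ', Exec (StackProg.while (fun v => v.fst.isSome) (seq p (popFst r)))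
        v ρ v' ρ' ((B + 2) * l.length + 1) ∧ P [] v' ρ' ∧ v'.fst = none ∧ ρ' r = [] := by
    intro l
    induction l with
    | nil =>
      intro v ρ hP hv hρ
      exact ⟨v, ρ, (Exec.while_done (by simp [hv])).mono (by omega), hP, hv, hρ⟩
    | cons b l ih =>
      intro v ρ hP hv hρ
      obtain ⟨v₁, ρ₁, h₁, hr, hP₁⟩ := h b l v ρ hP hv hρ
      obtain ⟨v₂, ρ₂, h₂, hP₂⟩ := ih _ _ hP₁ rfl (by simp)
      refine ⟨v₂, ρ₂, (Exec.while_step (B₂ := (B + 2) * l.length + 1) (by simp [hv])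
        (h₁.seq (Exec.pop r _)) ?_).mono ?_, hP₂⟩
      · rw [hr]; exact h₂
      · rw [List.length_cons, mul_add]; omega
  obtain ⟨v', ρ', h', hP'⟩ := key l _ _ h₀ rfl (by simp)
  refine ⟨v', ρ', ((Exec.pop r _).seq (B₂ := (B + 2) * l.length + 1) ?_).mono ?_, hP'⟩
  · rw [hl]; exact h'
  · omega

theorem exec_clear (r : R) (v : Memory G) (ρ : R → List Bool) :
    Exec (clear r) v ρ { v with fst := none } (Function.update ρ r []) (3 * (ρ r).length + 2) := by
  obtain ⟨v', ρ', h, ⟨rfl, h₁⟩, h₂, h₃⟩ := exec_forEach (r := r) (p := load id) (v := v) (ρ := ρ) rfl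
    (B := 1) (fun l v' ρ' => v' = { v with fst := l.head? } ∧ ρ' = Function.update ρ r l.tail)
    ⟨rfl, rfl⟩ fun b l v₁ ρ₁ hP hb hl =>
      ⟨v₁, ρ₁, Exec.load _, hl, by rw [hP.1], by rw [hP.2, Function.update_idem]⟩
  subst h₁
  exact h

theorem exec_move {r r₁ : R} (hr : r₁ ≠ r) (v : Memory G) (ρ : R → List Bool) :
    Exec (move r r₁) v ρ { v with fst := none }
      (Function.update (Function.update ρ r []) r₁ ((ρ r).reverse ++ ρ r₁))
      (3 * (ρ r).length + 2) := by
  obtain ⟨v', ρ', h, ⟨rfl, l', h₁, h₂⟩, -, -⟩ := exec_forEach (r := r) (p := pushFst r₁) (v := v)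
    (ρ := ρ) rfl (B := 1) (fun l v' ρ' => v' = { v with fst := l.head? } ∧ ∃ l', ρ r = l' ++ l ∧
      ρ' = Function.update (Function.update ρ r l.tail) r₁ (l'.reverse ++ ρ r₁))
    ⟨rfl, [], rfl, by
      funext r'; simp only [Function.update_apply]; split_ifs <;> simp_all⟩
    fun b l v₁ ρ₁ ⟨hP, l', h₁, h₂⟩ hb hl =>
      ⟨v₁, _, Exec.push _ _, by simp [hr.symm, hl], by rw [hP], l' ++ [b], by simp [h₁], by
        subst h₂
        funext r'; simp only [Function.update_apply, hb]; split_ifs <;> simp_all⟩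
  subst h₂
  simpa [h₁, move] using h

theorem exec_move₂ {r r₁ r₂ : R} (h₁ : r₁ ≠ r) (h₂ : r₂ ≠ r) (h₁₂ : r₁ ≠ r₂) (v : Memory G)
    (ρ : R → List Bool) :
    Exec (move₂ r r₁ r₂) v ρ { v with fst := none }
      (Function.update (Function.update (Function.update ρ r []) r₁ ((ρ r).reverse ++ ρ r₁)) r₂
        ((ρ r).reverse ++ ρ r₂))
      (4 * (ρ r).length + 2) := by
  obtain ⟨v', ρ', h, ⟨rfl, l', h₃, h₄⟩, -, -⟩ := exec_forEach (r := r)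
    (p := seq (pushFst r₁) (pushFst r₂)) (v := v)
    (ρ := ρ) rfl (B := 2) (fun l v' ρ' => v' = { v with fst := l.head? } ∧ ∃ l', ρ r = l' ++ l ∧
      ρ' = Function.update (Function.update (Function.update ρ r l.tail) r₁ (l'.reverse ++ ρ r₁)) r₂
        (l'.reverse ++ ρ r₂))
    ⟨rfl, [], rfl, by
      funext r'; simp only [Function.update_apply]; split_ifs <;> simp_all⟩
    fun b l v₁ ρ₁ ⟨hP, l', h₃, h₄⟩ hb hl =>
      ⟨v₁, _, (Exec.push _ _).seq (Exec.push _ _), by simp [h₁.symm, h₂.symm, hl], by rw [hP],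
        l' ++ [b], by simp [h₃], by
        subst h₄
        funext r'; simp only [Function.update_apply, hb]; split_ifs <;> simp_all⟩
  subst h₄
  simpa [h₃, move₂] using h

theorem exec_seek {x a tmp buf : R} (h₁ : a ≠ x) (h₂ : tmp ≠ x) (h₃ : buf ≠ x) (h₄ : tmp ≠ a)
    (h₅ : buf ≠ a) (h₆ : buf ≠ tmp) (v : Memory G) (ρ : R → List Bool) (htmp : ρ tmp = [])
    (hbuf : ρ buf = []) :
    ∃ v', Exec (seek x a tmp buf) v ρ v'
      (Function.update (Function.update (Function.update (Function.update ρ x [])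
        tmp (ρ x).reverse) a ((ρ a).drop (ρ x).length)) buf ((ρ a).take (ρ x).length).reverse)
      (6 * (ρ x).length + 2) := by
  obtain ⟨v', ρ', h, ⟨l', h₇, h₈⟩, -, -⟩ := exec_forEach (r := x) (v := v) (ρ := ρ) rfl (B := 4)
    (p := seq (pushFst tmp) (seq (popSnd a)
      (ite (fun v => v.snd.isSome) (pushSnd buf) (load id))))
    (fun l v' ρ' => ∃ l', ρ x = l' ++ l ∧
      ρ' = Function.update (Function.update (Function.update (Function.update ρ x l.tail)
        tmp l'.reverse) a ((ρ a).drop l'.length)) buf ((ρ a).take l'.length).reverse)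
    ⟨[], rfl, by
      funext r'; simp only [Function.update_apply]; split_ifs <;> simp_all⟩
    fun b l v₁ ρ₁ ⟨l', h₇, h₈⟩ hb hl => by
      -- If the array is exhausted, the pop returns nothing and nothing is pushed; `take` and `drop`
      -- do not change any more either, so no bound on the position is needed.
      rcases hd : (ρ a).drop l'.length with - | ⟨c, d⟩
      · refine ⟨_, _, (((Exec.push _ _).seq ((Exec.pop _ _).seq (Exec.ite_false ?_
          (Exec.load _)))).mono (by omega)), ?_, l' ++ [b], ?_, ?_⟩
        · subst h₈
          simp [h₄.symm, h₅.symm, hd]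
        · simp [h₁.symm, h₂.symm, hl]
        · simp [h₇]
        · subst h₈
          have hd₁ : (ρ a).drop (l'.length + 1) = [] := by
            rw [List.drop_eq_nil_iff] at hd ⊢; omega
          have hd₂ : (ρ a).take (l'.length + 1) = (ρ a).take l'.length := by
            rw [List.drop_eq_nil_iff] at hd
            rw [List.take_of_length_le hd, List.take_of_length_le (by omega)]
          funext r'
          simp only [Function.update_apply, hb]
          split_ifs <;> simp_all
      · refine ⟨_, _, (((Exec.push _ _).seq ((Exec.pop _ _).seq (Exec.ite_true ?_
          (Exec.push _ _)))).mono (by omega)), ?_, l' ++ [b], ?_, ?_⟩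
        · subst h₈
          simp [h₄.symm, h₅.symm, hd]
        · simp [h₁.symm, h₂.symm, h₃.symm, hl]
        · simp [h₇]
        · subst h₈
          have hd₁ : (ρ a).drop (l'.length + 1) = d := by
            rw [← List.tail_drop, hd, List.tail_cons]
          have hd₂ : (ρ a).take (l'.length + 1) = (ρ a).take l'.length ++ [c] := by
            rw [List.take_add, hd]; rfl
          funext r'
          simp only [Function.update_apply, hb]
          split_ifs <;> simp_all
  subst h₈
  rw [List.append_nil] at h₇
  subst h₇
  exact ⟨_, h⟩

end StackProg

/-! ### Programs with counters, arrays and bounded loops -/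

/-- Programs that act on counters, indexed by `C`, and on arrays of bits, indexed by `A`. Their only
loops are repeated a fixed number of times, the length of the input. The number of remaining
repetitions is kept in a register, indexed by `T`. -/
inductive Cmd (C A T : Type) : Type
  | skip
  | inc (x : C)
  | dec (x : C)
  | zero (x : C)
  | set (a : A) (x : C) (b : Bool)
  | cons (a : A) (b : Bool)
  | nil (a : A)
  | seq (p q : Cmd C A T)
  | ifEq (x y : C) (p q : Cmd C A T)
  | ifBit (a : A) (x : C) (p q : Cmd C A T)
  | loop (t : T) (p : Cmd C A T)

/-- The values of counters and arrays. -/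
structure Store (C A : Type) where
  cnt : C → ℕ
  arr : A → List Bool

namespace Store

variable {C A : Type}

/-- Assign a value to a counter. -/
def setCnt [DecidableEq C] (s : Store C A) (x : C) (n : ℕ) : Store C A := { s with cnt := Function.update s.cnt x n }

/-- Assign a value to an array. -/
def setArr [DecidableEq A] (s : Store C A) (a : A) (l : List Bool) : Store C A :=
  { s with arr := Function.update s.arr a l }

/-- All counters and all lengths of arrays are at most `B`. -/
def Bounded (s : Store C A) (B : ℕ) : Prop := (∀ x, s.cnt x ≤ B) ∧ ∀ a, (s.arr a).length ≤ B

theorem Bounded.mono {s : Store C A} {B B' : ℕ} (h : s.Bounded B) (hB : B ≤ B') : s.Bounded B' :=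
  ⟨fun x => (h.1 x).trans hB, fun a => (h.2 a).trans hB⟩

theorem Bounded.setCnt [DecidableEq C] {s : Store C A} {B : ℕ} (h : s.Bounded B) {x : C} {n : ℕ} (hn : n ≤ B) :
    (s.setCnt x n).Bounded B := by
  refine ⟨fun y => ?_, h.2⟩
  simp only [Store.setCnt, Function.update_apply]
  split_ifs
  exacts [hn, h.1 y]

theorem Bounded.setArr [DecidableEq A] {s : Store C A} {B : ℕ} (h : s.Bounded B) {a : A} {l : List Bool}
    (hl : l.length ≤ B) : (s.setArr a l).Bounded B := by
  refine ⟨h.1, fun b => ?_⟩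
  simp only [Store.setArr, Function.update_apply]
  split_ifs
  exacts [hl, h.2 b]

end Store

namespace Cmd

open StackProg

variable {C A T : Type} [DecidableEq C] [DecidableEq A]

/-- The effect of a program whose loops are repeated `N` times. -/
def eval (N : ℕ) : Cmd C A T → Store C A → Store C A
  | skip, s => s
  | inc x, s => s.setCnt x (s.cnt x + 1)
  | dec x, s => s.setCnt x (s.cnt x - 1)
  | zero x, s => s.setCnt x 0
  | set a x b, s => s.setArr a ((s.arr a).set (s.cnt x) b)
  | cons a b, s => s.setArr a (b :: s.arr a)
  | nil a, s => s.setArr a []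
  | seq p q, s => q.eval N (p.eval N s)
  | ifEq x y p q, s => if s.cnt x = s.cnt y then p.eval N s else q.eval N s
  | ifBit a x p q, s => if (s.arr a).getD (s.cnt x) false then p.eval N s else q.eval N s
  | loop _ p, s => (p.eval N)^[N] s

/-- The growth is additive and independent of `B`, since a basic command adds at most one to a
counter or to a length. Therefore `N` iterations add only `N` times the growth of the body, and
nesting loops multiplies polynomials instead of composing them. -/
theorem exists_growth (p : Cmd C A T) : ∃ g : Polynomial ℕ, ∀ (N : ℕ) (s : Store C A) (B : ℕ),
    s.Bounded B → (p.eval N s).Bounded (B + g.eval N) := by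
  induction p with
  | skip => exact ⟨0, fun N s B h => h.mono (by simp)⟩
  | inc x =>
    refine ⟨1, fun N s B h => (h.mono (by simp)).setCnt ?_⟩
    simpa using h.1 x
  | dec x =>
    refine ⟨1, fun N s B h => (h.mono (by simp)).setCnt ?_⟩
    have := h.1 x
    simp; omega
  | zero x => exact ⟨1, fun N s B h => (h.mono (by simp)).setCnt (by simp)⟩
  | set a x b =>
    refine ⟨1, fun N s B h => (h.mono (by simp)).setArr ?_⟩
    have := h.2 a
    simp; omega
  | cons a b =>
    refine ⟨1, fun N s B h => (h.mono (by simp)).setArr ?_⟩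
    simpa using h.2 a
  | nil a => exact ⟨1, fun N s B h => (h.mono (by simp)).setArr (by simp)⟩
  | seq p q ihp ihq =>
    obtain ⟨g, hg⟩ := ihp
    obtain ⟨g', hg'⟩ := ihq
    exact ⟨g + g', fun N s B h => (hg' N _ _ (hg N s B h)).mono (by simp [add_assoc])⟩
  | ifEq x y p q ihp ihq =>
    obtain ⟨g, hg⟩ := ihp
    obtain ⟨g', hg'⟩ := ihq
    refine ⟨g + g', fun N s B h => ?_⟩
    simp only [eval]
    split_ifs
    · exact (hg N s B h).mono (by simp)
    · exact (hg' N s B h).mono (by simp)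
  | ifBit a x p q ihp ihq =>
    obtain ⟨g, hg⟩ := ihp
    obtain ⟨g', hg'⟩ := ihq
    refine ⟨g + g', fun N s B h => ?_⟩
    simp only [eval]
    split_ifs
    · exact (hg N s B h).mono (by simp)
    · exact (hg' N s B h).mono (by simp)
  | loop t p ih =>
    obtain ⟨g, hg⟩ := ih
    refine ⟨Polynomial.X * g, fun N s B h => ?_⟩
    have key : ∀ i, ((p.eval N)^[i] s).Bounded (B + i * g.eval N) := by
      intro i
      induction i with
      | zero => simpa using h
      | succ i ih =>
        rw [Function.iterate_succ_apply']
        exact (hg N _ _ ih).mono (by ring_nf; rfl)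
    simpa [eval] using key N

/-! ### From programs with counters and arrays to programs on stacks. -/

/-- The registers of a compiled program. -/
inductive Reg (C A T : Type)
  | len
  | out
  | tmp
  | buf
  | cnt (x : C)
  | arr (a : A)
  | loop (t : T)
  deriving DecidableEq

/-- A register is a counter, an array, a loop register or one of four others. -/
def Reg.equiv (C A T : Type) : Reg C A T ≃ (C ⊕ A ⊕ T) ⊕ Fin 4 where
  toFun
    | .len => .inr 0
    | .out => .inr 1
    | .tmp => .inr 2
    | .buf => .inr 3
    | .cnt x => .inl (.inl x)
    | .arr a => .inl (.inr (.inl a))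
    | .loop t => .inl (.inr (.inr t))
  invFun
    | .inr 0 => .len
    | .inr 1 => .out
    | .inr 2 => .tmp
    | .inr 3 => .buf
    | .inl (.inl x) => .cnt x
    | .inl (.inr (.inl a)) => .arr a
    | .inl (.inr (.inr t)) => .loop t
  left_inv r := by cases r <;> rfl
  right_inv r := by
    rcases r with (r | r | r) | r
    · rfl
    · rfl
    · rfl
    · fin_cases r <;> rfl

instance [Fintype C] [Fintype A] [Fintype T] : Fintype (Reg C A T) :=
  Fintype.ofEquiv _ (Reg.equiv C A T).symm

/-- The stacks that represent a store. -/
def regs (N : ℕ) (s : Store C A) (τ : T → List Bool) : Reg C A T → List Bool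
  | .len => List.replicate N true
  | .out => []
  | .tmp => []
  | .buf => []
  | .cnt x => List.replicate (s.cnt x) true
  | .arr a => s.arr a
  | .loop t => τ t

variable {G : Type}

/-- The translation of a program into a program on stacks. -/
def compile : Cmd C A T → StackProg (Reg C A T) (Memory G)
  | skip => load id
  | inc x => push (.cnt x) fun _ => true
  | dec x => popFst (.cnt x)
  | zero x => clear (.cnt x)
  | set a x b => .seq (seek (.cnt x) (.arr a) .tmp .buf) <| .seq (popSnd (.arr a)) <|
      .seq (ite (fun v => v.snd.isSome) (push (.arr a) fun _ => b) (load id)) <|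
      .seq (move .tmp (.cnt x)) (move .buf (.arr a))
  | cons a b => push (.arr a) fun _ => b
  | nil a => clear (.arr a)
  | seq p q => .seq p.compile q.compile
  | ifEq x y p q => .seq (popFst (.cnt x)) <| .seq (popSnd (.cnt y)) <|
      .seq (StackProg.while (fun v => v.fst.isSome && v.snd.isSome) <|
        .seq (pushFst .tmp) <| .seq (popFst (.cnt x)) (popSnd (.cnt y))) <|
      .seq (load fun v => { v with flag := v.fst.isNone && v.snd.isNone }) <|
      .seq (ite (fun v => v.fst.isSome) (pushFst (.cnt x)) (load id)) <|
      .seq (ite (fun v => v.snd.isSome) (pushSnd (.cnt y)) (load id)) <|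
      .seq (move₂ .tmp (.cnt x) (.cnt y)) <| ite (fun v => v.flag) p.compile q.compile
  | ifBit a x p q => .seq (seek (.cnt x) (.arr a) .tmp .buf) <| .seq (popSnd (.arr a)) <|
      .seq (ite (fun v => v.snd.isSome) (pushSnd (.arr a)) (load id)) <|
      .seq (load fun v => { v with flag := v.snd.getD false }) <|
      .seq (move .tmp (.cnt x)) <| .seq (move .buf (.arr a)) <|
      ite (fun v => v.flag) p.compile q.compile
  | loop t p => .seq (move₂ .len .tmp (.loop t)) <| .seq (move .tmp .len) <|
      forEach (.loop t) p.compile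

/-- The loop registers that a program uses. -/
def loops : Cmd C A T → List T
  | seq p q => p.loops ++ q.loops
  | ifEq _ _ p q => p.loops ++ q.loops
  | ifBit _ _ p q => p.loops ++ q.loops
  | loop t p => t :: p.loops
  | _ => []

/-- Nested loops use distinct registers, and comparisons are between distinct counters. -/
def WellFormed : Cmd C A T → Prop
  | seq p q => p.WellFormed ∧ q.WellFormed
  | ifEq x y p q => x ≠ y ∧ p.WellFormed ∧ q.WellFormed
  | ifBit _ _ p q => p.WellFormed ∧ q.WellFormed
  | loop t p => t ∉ p.loops ∧ p.WellFormed
  | _ => True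

variable [DecidableEq T]

theorem update_regs_cnt (N : ℕ) (s : Store C A) (τ : T → List Bool) (x : C) (n : ℕ) :
    Function.update (regs N s τ) (.cnt x) (List.replicate n true) = regs N (s.setCnt x n) τ := by
  funext r
  cases r <;> simp [regs, Store.setCnt, Function.update_apply]
  split_ifs <;> simp_all

theorem update_regs_arr (N : ℕ) (s : Store C A) (τ : T → List Bool) (a : A) (l : List Bool) :
    Function.update (regs N s τ) (.arr a) l = regs N (s.setArr a l) τ := by
  funext r
  cases r <;> simp [regs, Store.setArr, Function.update_apply]

theorem update_regs_loop (N : ℕ) (s : Store C A) (τ : T → List Bool) (t : T) (l : List Bool) :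
    Function.update (regs N s τ) (.loop t) l = regs N s (Function.update τ t l) := by
  funext r
  cases r <;> simp [regs, Function.update_apply]

variable {N : ℕ} {s : Store C A} {τ : T → List Bool} {v : Memory G} {B : ℕ}

/-- The stacks while the bit at position `s.cnt x` of the array `a` is accessed. -/
def openRegs (N : ℕ) (s : Store C A) (τ : T → List Bool) (a : A) (x : C) (l : List Bool) :
    Reg C A T → List Bool
  | .cnt y => if y = x then [] else List.replicate (s.cnt y) true
  | .tmp => List.replicate (s.cnt x) true
  | .buf => ((s.arr a).take (s.cnt x)).reverse
  | .arr a' => if a' = a then l else s.arr a'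
  | r => regs N s τ r

theorem update_openRegs (N : ℕ) (s : Store C A) (τ : T → List Bool) (a : A) (x : C)
    (l l' : List Bool) :
    Function.update (openRegs N s τ a x l) (.arr a) l' = openRegs N s τ a x l' := by
  funext r
  cases r <;> simp [openRegs, Function.update_apply]
  split_ifs <;> simp_all

theorem exec_openRegs (h : s.Bounded B) (a : A) (x : C) (v : Memory G) :
    ∃ v', v'.snd = (s.arr a)[s.cnt x]? ∧
      Exec (.seq (seek (.cnt x) (.arr a) .tmp .buf) (popSnd (.arr a))) v (regs N s τ) v'
        (openRegs N s τ a x ((s.arr a).drop (s.cnt x + 1))) (6 * B + 3) := by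
  obtain ⟨v₁, h₁⟩ := exec_seek (x := Reg.cnt x) (a := Reg.arr a) (tmp := Reg.tmp) (buf := Reg.buf)
    (by simp) (by simp) (by simp) (by simp) (by simp) (by simp) v (regs N s τ) rfl rfl
  have hx := h.1 x
  have e : Function.update (Function.update (Function.update (Function.update (regs N s τ)
      (.cnt x) []) .tmp (regs N s τ (.cnt x)).reverse) (.arr a) ((regs N s τ (.arr a)).drop
        (regs N s τ (.cnt x)).length)) .buf ((regs N s τ (.arr a)).take
        (regs N s τ (.cnt x)).length).reverse =
      openRegs N s τ a x ((s.arr a).drop (s.cnt x)) := by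
    funext r
    cases r <;> simp [regs, openRegs, Function.update_apply]
  rw [e] at h₁
  refine ⟨_, ?_, ((h₁.seq (Exec.pop (Reg.arr a) _)).mono ?_).cast ?_⟩
  · simp [openRegs]
  · simp only [regs, List.length_replicate]
    omega
  · rw [update_openRegs]
    simp [openRegs]

theorem exec_closeRegs (h : s.Bounded B) (a : A) (x : C) (l : List Bool) (v : Memory G) :
    Exec (.seq (move .tmp (.cnt x)) (move .buf (.arr a))) v (openRegs N s τ a x l)
      { v with fst := none } (regs N (s.setArr a ((s.arr a).take (s.cnt x) ++ l)) τ)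
      (6 * B + 4) := by
  have hx := h.1 x
  refine (((exec_move (by simp) v _).seq (exec_move (by simp) _ _)).mono ?_).cast ?_
  · simp [openRegs]
    omega
  · funext r
    cases r <;> simp [regs, openRegs, Function.update_apply, Store.setArr] <;> split_ifs <;>
      simp_all

theorem exec_set (h : s.Bounded B) (a : A) (x : C) (b : Bool) (v : Memory G) :
    ∃ v', Exec (set a x b).compile v (regs N s τ) v' (regs N ((set a x b : Cmd C A T).eval N s) τ)
      (12 * B + 9) := by
  obtain ⟨v₁, hv, h₁⟩ := exec_openRegs (N := N) (τ := τ) h a x v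
  have key : Exec (ite (fun v : Memory G => v.snd.isSome) (push (.arr a) fun _ => b) (load id)) v₁
      (openRegs N s τ a x ((s.arr a).drop (s.cnt x + 1))) v₁ (openRegs N s τ a x
        (((s.arr a).set (s.cnt x) b).drop (s.cnt x))) 2 := by
    by_cases hlt : s.cnt x < (s.arr a).length
    · refine (Exec.ite_true (by simp [hv, hlt]) (Exec.push _ _)).cast ?_
      rw [update_openRegs, List.set_eq_take_append_cons_drop, if_pos hlt,
        List.drop_append_of_le_length (by simp; omega)]
      simp [openRegs]
    -- Beyond the end of the array nothing is written, in agreement with `List.set`.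
    · refine (Exec.ite_false (by simp [hv, hlt]) (Exec.load _)).cast ?_
      rw [List.drop_eq_nil_of_le (by omega), List.drop_eq_nil_of_le (by simp; omega)]
  refine ⟨_, ((h₁.assoc (key.seq (exec_closeRegs h a x _ _))).mono (by omega)).cast ?_⟩
  rw [eval]
  congr 2
  conv_rhs => rw [← List.take_append_drop (s.cnt x) ((s.arr a).set (s.cnt x) b)]
  rw [List.take_set_of_le le_rfl]

theorem exec_ifBit (h : s.Bounded B) (a : A) (x : C) (p q : Cmd C A T) (v : Memory G) {B' : ℕ}
    (hp : ∀ v : Memory G, ∃ v', Exec p.compile v (regs N s τ) v' (regs N (p.eval N s) τ) B')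
    (hq : ∀ v : Memory G, ∃ v', Exec q.compile v (regs N s τ) v' (regs N (q.eval N s) τ) B') :
    ∃ v', Exec (ifBit a x p q).compile v (regs N s τ) v'
      (regs N ((ifBit a x p q).eval N s) τ) (12 * B + 11 + B') := by
  obtain ⟨v₁, hv, h₁⟩ := exec_openRegs (N := N) (τ := τ) h a x v
  have key : Exec (ite (fun v : Memory G => v.snd.isSome) (pushSnd (.arr a)) (load id)) v₁
      (openRegs N s τ a x ((s.arr a).drop (s.cnt x + 1))) v₁ (openRegs N s τ a x
        ((s.arr a).drop (s.cnt x))) 2 := by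
    by_cases hlt : s.cnt x < (s.arr a).length
    · refine (Exec.ite_true (by simp [hv, hlt]) (Exec.push _ _)).cast ?_
      rw [update_openRegs, hv, List.drop_eq_getElem_cons hlt]
      simp [openRegs, hlt]
    · refine (Exec.ite_false (by simp [hv, hlt]) (Exec.load _)).cast ?_
      rw [List.drop_eq_nil_of_le (by omega), List.drop_eq_nil_of_le (by omega)]
  have h₂ := exec_closeRegs (N := N) (τ := τ) h a x ((s.arr a).drop (s.cnt x))
    { v₁ with flag := v₁.snd.getD false }
  have e : s.setArr a ((s.arr a).take (s.cnt x) ++ (s.arr a).drop (s.cnt x)) = s := by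
    rw [List.take_append_drop]
    simp [Store.setArr]
  rw [e] at h₂
  have hb : (s.arr a).getD (s.cnt x) false = v₁.snd.getD false := by
    rw [hv, List.getD_eq_getElem?_getD]
  simp only [eval, hb]
  cases hc : v₁.snd.getD false
  · obtain ⟨v', hq⟩ := hq { v₁ with flag := v₁.snd.getD false, fst := none }
    exact ⟨v', ((h₁.assoc (key.seq ((Exec.load _).seq (h₂.assoc (Exec.ite_false hc hq))))).mono
      (by omega)).cast (by simp)⟩
  · obtain ⟨v', hp⟩ := hp { v₁ with flag := v₁.snd.getD false, fst := none }
    exact ⟨v', ((h₁.assoc (key.seq ((Exec.load _).seq (h₂.assoc (Exec.ite_true hc hp))))).mono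
      (by omega)).cast (by simp)⟩

/-- The stacks while the counters `x` and `y` are compared. -/
def compareRegs (N : ℕ) (s : Store C A) (τ : T → List Bool) (x y : C) (i j k : ℕ) :
    Reg C A T → List Bool
  | .cnt z => if z = x then List.replicate i true else if z = y then List.replicate j true else
      List.replicate (s.cnt z) true
  | .tmp => List.replicate k true
  | r => regs N s τ r

theorem update_compareRegs_left (N : ℕ) (s : Store C A) (τ : T → List Bool) (x y : C)
    (i j k n : ℕ) : Function.update (compareRegs N s τ x y i j k) (.cnt x)
      (List.replicate n true) = compareRegs N s τ x y n j k := by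
  funext r
  cases r <;> simp [compareRegs, regs, Function.update_apply]
  split_ifs <;> simp_all

theorem update_compareRegs_right (N : ℕ) (s : Store C A) (τ : T → List Bool) {x y : C}
    (h : x ≠ y) (i j k n : ℕ) : Function.update (compareRegs N s τ x y i j k) (.cnt y)
      (List.replicate n true) = compareRegs N s τ x y i n k := by
  funext r
  cases r <;> simp [compareRegs, regs, Function.update_apply]
  split_ifs <;> simp_all

theorem update_compareRegs_tmp (N : ℕ) (s : Store C A) (τ : T → List Bool) (x y : C)
    (i j k n : ℕ) : Function.update (compareRegs N s τ x y i j k) .tmp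
      (List.replicate n true) = compareRegs N s τ x y i j n := by
  funext r
  cases r <;> simp [compareRegs, regs]

theorem exec_pop_pop (N : ℕ) (s : Store C A) (τ : T → List Bool) {x y : C} (h : x ≠ y)
    (i j k : ℕ) (v : Memory G) :
    Exec (.seq (popFst (.cnt x)) (popSnd (.cnt y))) v (compareRegs N s τ x y i j k)
      ⟨v.sym, (List.replicate i true).head?, (List.replicate j true).head?, v.flag⟩
      (compareRegs N s τ x y (i - 1) (j - 1) k) 2 := by
  have e₁ : compareRegs N s τ x y i j k (.cnt x) = List.replicate i true := by simp [compareRegs]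
  have e₂ : compareRegs N s τ x y (i - 1) j k (.cnt y) = List.replicate j true := by
    simp [compareRegs, h.symm]
  have h₁ := Exec.pop (ρ := compareRegs N s τ x y i j k) (v := v) (Reg.cnt x)
    fun v a => { v with fst := a }
  rw [e₁, List.tail_replicate, update_compareRegs_left] at h₁
  have h₂ := Exec.pop (ρ := compareRegs N s τ x y (i - 1) j k)
    (v := { v with fst := (List.replicate i true).head? }) (Reg.cnt y)
    fun v a => { v with snd := a }
  rw [e₂, List.tail_replicate, update_compareRegs_right _ _ _ h] at h₂
  exact h₁.seq h₂

/-- One mark of each counter is held in the memory, which is why the stacks contain `i - 1` and `j -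
1` marks. Each of the `min i j` rounds records on `tmp` a pair of marks that has been removed. -/
theorem exec_compare_while (N : ℕ) (s : Store C A) (τ : T → List Bool) {x y : C} (hxy : x ≠ y)
    (m : ℕ) : ∀ (i j k : ℕ) (v : Memory G), min i j = m → v.fst = (List.replicate i true).head? →
    v.snd = (List.replicate j true).head? →
    Exec (StackProg.while (fun v => v.fst.isSome && v.snd.isSome) <|
        .seq (pushFst .tmp) <| .seq (popFst (.cnt x)) (popSnd (.cnt y))) v
      (compareRegs N s τ x y (i - 1) (j - 1) k)
      ⟨v.sym, (List.replicate (i - m) true).head?, (List.replicate (j - m) true).head?, v.flag⟩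
      (compareRegs N s τ x y (i - m - 1) (j - m - 1) (k + m)) (4 * m + 1) := by
  induction m with
  | zero =>
    intro i j k v hm hi hj
    rw [Nat.sub_zero, Nat.sub_zero, ← hi, ← hj]
    refine (Exec.while_done ?_)
    rcases Nat.min_eq_zero_iff.1 hm with rfl | rfl
    · simp [hi]
    · simp [hj]
  | succ m ih =>
    intro i j k v hm hi hj
    obtain ⟨i, rfl⟩ : ∃ i', i = i' + 1 := ⟨i - 1, by omega⟩
    obtain ⟨j, rfl⟩ : ∃ j', j = j' + 1 := ⟨j - 1, by omega⟩
    have h := ih i j (k + 1) ⟨v.sym, (List.replicate i true).head?,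
      (List.replicate j true).head?, v.flag⟩ (by omega) rfl rfl
    have h₁ : Exec (pushFst .tmp) v (compareRegs N s τ x y i j k) v
        (compareRegs N s τ x y i j (k + 1)) 1 := by
      refine (Exec.push _ _).cast ?_
      rw [← update_compareRegs_tmp N s τ x y i j k (k + 1), hi]
      simp [compareRegs, List.replicate_succ]
    simp only [Nat.add_sub_cancel, Nat.add_sub_add_right]
    refine ((Exec.while_step (by simp [hi, hj, List.replicate_succ]) (h₁.seq
      (exec_pop_pop N s τ hxy i j (k + 1) v)) h).mono (by omega)).cast ?_
    rw [add_assoc, add_comm 1 m]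

/-- Marks are removed in pairs until one counter runs out; the counters are equal iff neither leaves
a mark in the memory. A leftover mark is pushed back, and the pairs recorded on `tmp` restore both
counters. If `x` and `y` were the same stack, the two pops of a pair would interfere. -/
theorem exec_ifEq (h : s.Bounded B) {x y : C} (hxy : x ≠ y) (p q : Cmd C A T) (v : Memory G)
    {B' : ℕ}
    (hp : ∀ v : Memory G, ∃ v', Exec p.compile v (regs N s τ) v' (regs N (p.eval N s) τ) B')
    (hq : ∀ v : Memory G, ∃ v', Exec q.compile v (regs N s τ) v' (regs N (q.eval N s) τ) B') :
    ∃ v', Exec (ifEq x y p q).compile v (regs N s τ) v'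
      (regs N ((ifEq x y p q).eval N s) τ) (8 * B + 11 + B') := by
  have hx := h.1 x
  set i := s.cnt x with hi
  set j := s.cnt y with hj
  set m := min i j with hm
  have e : regs N s τ = compareRegs N s τ x y i j 0 := by
    funext r
    cases r <;> simp [compareRegs, regs]
    split_ifs <;> simp_all
  have h₁ := exec_pop_pop N s τ hxy i j 0 v
  have h₂ := exec_compare_while N s τ hxy m i j 0 ⟨v.sym, (List.replicate i true).head?,
      (List.replicate j true).head?, v.flag⟩ rfl rfl rfl
  rw [zero_add] at h₂
  dsimp only at h₂
  set v₂ : Memory G := ⟨v.sym, (List.replicate (i - m) true).head?,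
    (List.replicate (j - m) true).head?, v.flag⟩ with hv₂
  set v₃ : Memory G := { v₂ with flag := v₂.fst.isNone && v₂.snd.isNone } with hv₃
  have h₃ : Exec (load fun v => { v with flag := v.fst.isNone && v.snd.isNone }) v₂
    (compareRegs N s τ x y (i - m - 1) (j - m - 1) m) v₃ _ 1 := Exec.load _
  have h₄ : Exec (ite (fun v => v.fst.isSome) (pushFst (.cnt x)) (load id)) v₃
      (compareRegs N s τ x y (i - m - 1) (j - m - 1) m) v₃
      (compareRegs N s τ x y (i - m) (j - m - 1) m) 2 := by
    rcases hn : i - m with - | n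
    · exact Exec.ite_false (by simp [hv₃, hv₂, hn]) (Exec.load _)
    · refine (Exec.ite_true (by simp [hv₃, hv₂, hn, List.replicate_succ]) (Exec.push _ _)).cast ?_
      rw [← update_compareRegs_left N s τ x y n (j - m - 1) m (n + 1)]
      simp [hv₃, hv₂, hn, compareRegs, List.replicate_succ]
  have h₅ : Exec (ite (fun v => v.snd.isSome) (pushSnd (.cnt y)) (load id)) v₃
      (compareRegs N s τ x y (i - m) (j - m - 1) m) v₃
      (compareRegs N s τ x y (i - m) (j - m) m) 2 := by
    rcases hn : j - m with - | n
    · exact Exec.ite_false (by simp [hv₃, hv₂, hn]) (Exec.load _)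
    · refine (Exec.ite_true (by simp [hv₃, hv₂, hn, List.replicate_succ]) (Exec.push _ _)).cast ?_
      rw [← update_compareRegs_right N s τ hxy (i - m) n m (n + 1)]
      simp [hv₃, hv₂, hn, compareRegs, List.replicate_succ, hxy.symm]
  have h₆ : Exec (move₂ .tmp (.cnt x) (.cnt y)) v₃ (compareRegs N s τ x y (i - m) (j - m) m)
      { v₃ with fst := none } (regs N s τ) (4 * m + 2) := by
    have hi' : m + (i - m) = i := by omega
    have hj' : m + (j - m) = j := by omega
    refine ((exec_move₂ (by simp) (by simp) (by simpa using hxy) v₃ _).mono ?_).cast ?_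
    · simp [compareRegs]
    · rw [e]
      funext r
      cases r <;> simp [compareRegs, regs, Function.update_apply, hxy.symm, hi', hj']
      split_ifs <;> simp_all
  have hf : v₃.flag = decide (i = j) := by
    rw [hv₃, hv₂]
    rcases lt_trichotomy i j with hij | hij | hij
    · rw [show j - m = (j - m - 1) + 1 by omega]
      simp [List.replicate_succ, hij.ne]
    · simp [hm, hij]
    · rw [show i - m = (i - m - 1) + 1 by omega]
      simp [List.replicate_succ, hij.ne']
  simp only [eval, ← hi, ← hj]
  by_cases hij : i = j
  · obtain ⟨v', hp⟩ := hp { v₃ with fst := none }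
    rw [← e] at h₁
    exact ⟨v', ((h₁.assoc (h₂.seq (h₃.seq (h₄.seq (h₅.seq (h₆.seq (Exec.ite_true
      (by simp [hf, hij]) hp))))))).mono (by omega)).cast (by simp [hij])⟩
  · obtain ⟨v', hq⟩ := hq { v₃ with fst := none }
    rw [← e] at h₁
    exact ⟨v', ((h₁.assoc (h₂.seq (h₃.seq (h₄.seq (h₅.seq (h₆.seq (Exec.ite_false
      (by simp [hf, hij]) hq))))))).mono (by omega)).cast (by simp [hij])⟩

/-- The register `len` is copied to the loop register, by way of `tmp`, and the copy is consumed.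
While the body runs, the loop register holds the remaining rounds, so the hypothesis on the body
allows an arbitrary content `l` there. -/
theorem exec_loop (t : T) (p : Cmd C A T) (v : Memory G) {B' : ℕ} (hτ : τ t = [])
    (hp : ∀ i < N, ∀ (v : Memory G) (l : List Bool), ∃ v', Exec p.compile v
      (regs N ((p.eval N)^[i] s) (Function.update τ t l)) v'
      (regs N ((p.eval N)^[i + 1] s) (Function.update τ t l)) B') :
    ∃ v', Exec (loop t p).compile v (regs N s τ) v' (regs N ((loop t p).eval N s) τ)
      ((B' + 9) * N + 6) := by
  have e : Function.update (Function.update (Function.update (Function.update (Function.update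
      (regs N s τ) .len []) .tmp (List.replicate N true)) (.loop t) (List.replicate N true))
      .tmp []) .len (List.replicate N true) = regs N s (Function.update τ t (List.replicate N true)) := by
    funext r
    cases r <;> simp [regs, Function.update_apply]
  have h₁ : Exec (.seq (move₂ .len .tmp (.loop t)) (move .tmp .len)) v (regs N s τ)
      { v with fst := none } (regs N s (Function.update τ t (List.replicate N true))) (7 * N + 4) := by
    refine (((exec_move₂ (by simp) (by simp) (by simp) v _).seq
      (exec_move (by simp) _ _)).mono ?_).cast ?_
    · simp [regs]
      omega
    · rw [← e]
      simp [regs, hτ]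
  obtain ⟨v', ρ', h₂, ⟨i, hi, h₃⟩, -, -⟩ := exec_forEach (r := Reg.loop t) (p := p.compile)
    (v := { v with fst := none }) (ρ := regs N s (Function.update τ t (List.replicate N true)))
    (l := List.replicate N true) (by simp [regs]) (B := B')
    (fun l v ρ => ∃ i, i + l.length = N ∧
      ρ = regs N ((p.eval N)^[i] s) (Function.update τ t l.tail))
    ⟨0, by simp, by rw [update_regs_loop, Function.update_idem]; rfl⟩
    fun b l v₁ ρ₁ ⟨i, hi, hρ⟩ hb hl => by
      rw [List.length_cons] at hi
      obtain ⟨v', h⟩ := hp i (by omega) v₁ l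
      exact ⟨v', _, hρ ▸ h, by simp [regs], i + 1, by omega, by
        rw [update_regs_loop, Function.update_idem]⟩
  refine ⟨v', ((h₁.assoc h₂).mono ?_).cast ?_⟩
  · rw [List.length_replicate]
    ring_nf
    omega
  · rw [h₃, eval]
    simp at hi
    rw [hi, List.tail_nil, ← hτ, Function.update_eq_self]

/-- The cost depends on the sizes of the data, as counters are unary. The quantification over all
bounds `b` makes the induction work: the second part of a composition starts from data bounded by `b
+ g`, and the body of a loop always from data bounded by `b + X * g`. -/
theorem exists_cost (p : Cmd C A T) (hw : p.WellFormed) : ∀ b : Polynomial ℕ, ∃ c : Polynomial ℕ,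
    ∀ (N : ℕ) (s : Store C A) (τ : T → List Bool) (v : Memory G), s.Bounded (b.eval N) →
      (∀ t ∈ p.loops, τ t = []) →
      ∃ v', Exec p.compile v (regs N s τ) v' (regs N (p.eval N s) τ) (c.eval N) := by
  induction p with
  | skip => exact fun b => ⟨1, fun N s τ v _ _ => ⟨_, (Exec.load _).mono (by simp)⟩⟩
  | inc x =>
    refine fun b => ⟨1, fun N s τ v _ _ => ⟨_, ((Exec.push _ _).mono (by simp)).cast ?_⟩⟩
    simp [eval, ← update_regs_cnt, regs, List.replicate_succ]
  | dec x =>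
    refine fun b => ⟨1, fun N s τ v _ _ => ⟨_, ((Exec.pop _ _).mono (by simp)).cast ?_⟩⟩
    simp [eval, ← update_regs_cnt, regs]
  | zero x =>
    refine fun b => ⟨3 * b + 2, fun N s τ v h _ => ⟨_, ((exec_clear _ _ _).mono ?_).cast ?_⟩⟩
    · have := h.1 x
      simp [regs]; omega
    · simp [eval, ← update_regs_cnt]
  | set a x bit =>
    refine fun b => ⟨12 * b + 9, fun N s τ v h _ => ?_⟩
    obtain ⟨v', h'⟩ := exec_set (N := N) (τ := τ) h a x bit v
    exact ⟨v', h'.mono (by simp)⟩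
  | cons a bit =>
    refine fun b => ⟨1, fun N s τ v _ _ => ⟨_, ((Exec.push _ _).mono (by simp)).cast ?_⟩⟩
    simp [eval, ← update_regs_arr, regs]
  | nil a =>
    refine fun b => ⟨3 * b + 2, fun N s τ v h _ => ⟨_, ((exec_clear _ _ _).mono ?_).cast ?_⟩⟩
    · have := h.2 a
      simp [regs]; omega
    · simp [eval, ← update_regs_arr]
  | seq p q ihp ihq =>
    intro b
    obtain ⟨g, hg⟩ := exists_growth p
    obtain ⟨c, hc⟩ := ihp hw.1 b
    obtain ⟨c', hc'⟩ := ihq hw.2 (b + g)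
    refine ⟨c + c', fun N s τ v h hτ => ?_⟩
    obtain ⟨v₁, h₁⟩ := hc N s τ v h fun t ht => hτ t (by simp [loops, ht])
    obtain ⟨v₂, h₂⟩ := hc' N (p.eval N s) τ v₁ (by simpa using hg N s _ h)
      fun t ht => hτ t (by simp [loops, ht])
    exact ⟨v₂, (h₁.seq h₂).mono (by simp)⟩
  | ifEq x y p q ihp ihq =>
    intro b
    obtain ⟨c, hc⟩ := ihp hw.2.1 b
    obtain ⟨c', hc'⟩ := ihq hw.2.2 b
    refine ⟨8 * b + 11 + (c + c'), fun N s τ v h hτ => ?_⟩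
    obtain ⟨v', h'⟩ := exec_ifEq (N := N) (τ := τ) h hw.1 p q v (B' := (c + c').eval N)
      (fun v => by
        obtain ⟨v', h'⟩ := hc N s τ v h fun t ht => hτ t (by simp [loops, ht])
        exact ⟨v', h'.mono (by simp)⟩)
      (fun v => by
        obtain ⟨v', h'⟩ := hc' N s τ v h fun t ht => hτ t (by simp [loops, ht])
        exact ⟨v', h'.mono (by simp)⟩)
    exact ⟨v', h'.mono (by simp)⟩
  | ifBit a x p q ihp ihq =>
    intro b
    obtain ⟨c, hc⟩ := ihp hw.1 b
    obtain ⟨c', hc'⟩ := ihq hw.2 b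
    refine ⟨12 * b + 11 + (c + c'), fun N s τ v h hτ => ?_⟩
    obtain ⟨v', h'⟩ := exec_ifBit (N := N) (τ := τ) h a x p q v (B' := (c + c').eval N)
      (fun v => by
        obtain ⟨v', h'⟩ := hc N s τ v h fun t ht => hτ t (by simp [loops, ht])
        exact ⟨v', h'.mono (by simp)⟩)
      (fun v => by
        obtain ⟨v', h'⟩ := hc' N s τ v h fun t ht => hτ t (by simp [loops, ht])
        exact ⟨v', h'.mono (by simp)⟩)
    exact ⟨v', h'.mono (by simp)⟩
  | loop t p ih =>
    intro b
    obtain ⟨g, hg⟩ := exists_growth p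
    obtain ⟨c, hc⟩ := ih hw.2 (b + Polynomial.X * g)
    refine ⟨(c + 9) * Polynomial.X + 6, fun N s τ v h hτ => ?_⟩
    have hb : ∀ i ≤ N, ((p.eval N)^[i] s).Bounded (b.eval N + i * g.eval N) := by
      intro i hi
      induction i with
      | zero => simpa using h
      | succ i ih =>
        rw [Function.iterate_succ_apply']
        exact (hg N _ _ (ih (by omega))).mono (by ring_nf; rfl)
    obtain ⟨v', h'⟩ := exec_loop (s := s) t p v (B' := c.eval N) (hτ t (by simp [loops]))
      fun i hi v l => by
        rw [Function.iterate_succ_apply']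
        refine hc N _ _ v ((hb i hi.le).mono ?_) fun t' ht' => ?_
        · simp only [Polynomial.eval_add, Polynomial.eval_mul, Polynomial.eval_X]
          gcongr
        -- The register of this loop is in use, but the loops in the body have other registers,
        -- which are still empty.
        · rw [Function.update_of_ne (fun e : t' = t => hw.1 (e ▸ ht'))]
          exact hτ t' (by simp [loops, ht'])
    exact ⟨v', h'.mono (by simp)⟩

/-! ### Cleaning up, and the passage to the class P. -/

/-- Empty all stacks in a list. -/
def clearAll {R : Type} : List R → StackProg R (Memory G)
  | [] => load id
  | r :: l => .seq (clear r) (clearAll l)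

theorem exec_clearAll {R : Type} [DecidableEq R] {B : ℕ} (l : List R) : ∀ (v : Memory G)
    (ρ : R → List Bool), (∀ r, (ρ r).length ≤ B) → ∃ v', v'.flag = v.flag ∧
      Exec (clearAll l) v ρ v' (fun r => if r ∈ l then [] else ρ r) (l.length * (3 * B + 2) + 1) := by
  induction l with
  | nil => exact fun v ρ _ => ⟨v, rfl, ((Exec.load _).mono (by simp)).cast (by simp)⟩
  | cons r l ih =>
    intro v ρ hρ
    obtain ⟨v', hv, h⟩ := ih { v with fst := none } (Function.update ρ r []) (fun r' => by
      rw [Function.update_apply]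
      split_ifs
      exacts [by simp, hρ r'])
    refine ⟨v', hv, (((exec_clear r v ρ).seq h).mono ?_).cast ?_⟩
    · have := hρ r
      rw [List.length_cons, add_mul]
      omega
    · funext r'
      by_cases h₁ : r' = r <;> by_cases h₂ : r' ∈ l <;> simp [h₁, h₂]

/-- A language is in P if it is decided by a program on counters and arrays that receives two
bits for each symbol of the input and accepts by leaving the counter `bad` empty. -/
theorem inP_of_eval [Fintype C] [Fintype A] [Fintype T] [Fintype G] [Inhabited G] {L : Language G}
    (f₁ f₂ : G → Bool) {a₁ a₂ : A} (ha : a₁ ≠ a₂) (bad : C) (p : Cmd C A T) (hp : p.WellFormed)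
    (h : ∀ w : List G, (p.eval w.length ⟨fun _ => 0, fun a => if a = a₁ then w.map f₁ else
      if a = a₂ then w.map f₂ else []⟩).cnt bad = 0 ↔ w ∈ L) : InP L := by
  obtain ⟨g, hg⟩ := exists_growth p
  obtain ⟨c, hc⟩ := exists_cost (G := G) p hp Polynomial.X
  -- The verdict is kept in `flag`, the field that `clearAll` preserves, while all stacks are
  -- emptied, and only then written to the output.
  refine inP_of_run (R := Reg C A T) (f₁ := f₁) (f₂ := f₂) (r₁ := .arr a₁) (r₂ := .arr a₂)
    (len := .len) (out := .out) (p := .seq p.compile <| .seq (popFst (.cnt bad)) <|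
      .seq (load fun v => { v with flag := v.fst.isNone }) <|
      .seq (clearAll Finset.univ.toList) (push .out fun v => v.flag))
    (by simpa using ha) (by simp) (by simp)
    (c + (2 + ((Fintype.card (Reg C A T) : Polynomial ℕ) * (3 * (Polynomial.X + g) + 2) + 2)))
    fun w => ?_
  set s : Store C A := ⟨fun _ => 0, fun a => if a = a₁ then w.map f₁ else
      if a = a₂ then w.map f₂ else []⟩ with hs
  have hsB : s.Bounded w.length := by
    refine ⟨fun x => by simp [hs], fun a => ?_⟩
    simp only [hs]
    split_ifs <;> simp
  have e : inputStacks f₁ f₂ (Reg.arr a₁) (.arr a₂) .len w = regs w.length s fun _ : T => [] := by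
    funext r
    cases r <;> simp [inputStacks, regs, hs]
  obtain ⟨v₁, h₁⟩ := hc w.length s (fun _ => []) {} (by simpa using hsB) (by simp)
  have hB := hg w.length s _ hsB
  set s' := p.eval w.length s with hs'
  set ρ := Function.update (regs w.length s' fun _ : T => []) (.cnt bad)
    (List.replicate (s'.cnt bad - 1) true) with hρ
  have hρB : ∀ r, (ρ r).length ≤ w.length + g.eval w.length := by
    intro r
    rw [hρ, update_regs_cnt]
    cases r with
    | cnt x =>
      have h₁ := hB.1 x
      have h₂ := hB.1 bad
      simp only [regs, Store.setCnt, Function.update_apply, List.length_replicate]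
      split_ifs <;> omega
    | arr a => exact hB.2 a
    | _ => simp [regs]
  have h₂ := Exec.pop (v := v₁) (ρ := regs w.length s' fun _ : T => []) (.cnt bad)
    fun v a => { v with fst := a }
  rw [show regs w.length s' (fun _ : T => []) (.cnt bad) = List.replicate (s'.cnt bad) true from rfl,
    List.tail_replicate] at h₂
  obtain ⟨v₂, hv₂, h₃⟩ := exec_clearAll Finset.univ.toList
    ⟨v₁.sym, (List.replicate (s'.cnt bad) true).head?, v₁.snd,
      (List.replicate (s'.cnt bad) true).head?.isNone⟩ ρ hρB
  have hf : v₂.flag = decide (s'.cnt bad = 0) := by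
    rw [hv₂]
    rcases s'.cnt bad with - | n <;> simp [List.replicate_succ]
  obtain ⟨t, ht, hrun⟩ := h₁.seq (h₂.seq ((Exec.load fun v => { v with flag := v.fst.isNone }).seq
    (h₃.seq (Exec.push .out fun v => v.flag))))
  refine ⟨decide (s'.cnt bad = 0), v₂, t, by simpa using h w, ht.trans ?_, ?_⟩
  · simp
    omega
  · rw [e]
    simpa [hf, popFst] using hrun

end Cmd

/-! ### Walks in digraphs -/

namespace Digraph

variable {V : Type*}

/-- There is a walk of length `t` from `u` to `v`. -/
def Walk (D : Digraph V) : ℕ → V → V → Prop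
  | 0, u, v => u = v
  | t + 1, u, v => ∃ x, D.Walk t u x ∧ D.Adj x v

variable {D : Digraph V} {u v w : V} {a b t m k : ℕ}

theorem Walk.add (h₁ : D.Walk a u v) (h₂ : D.Walk b v w) : D.Walk (a + b) u w := by
  induction b generalizing w with
  | zero => cases h₂; exact h₁
  | succ b ih =>
    obtain ⟨x, hx, hxw⟩ := h₂
    exact ⟨x, ih hx, hxw⟩

theorem walk_one : D.Walk 1 u v ↔ D.Adj u v := by
  simp [Walk]

theorem walk_of_path {c : ℕ → V} (i : ℕ) (hc : ∀ j < t, D.Adj (c (i + j)) (c (i + j + 1))) :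
    D.Walk t (c i) (c (i + t)) := by
  induction t with
  | zero => rfl
  | succ t ih => exact ⟨_, ih fun j hj => hc j (by omega), hc t (by omega)⟩

theorem Walk.exists_path (h : D.Walk t u v) :
    ∃ c : ℕ → V, c 0 = u ∧ c t = v ∧ ∀ i < t, D.Adj (c i) (c (i + 1)) := by
  induction t generalizing v with
  | zero => exact ⟨fun _ => u, rfl, h, by simp⟩
  | succ t ih =>
    obtain ⟨x, hx, hxv⟩ := h
    obtain ⟨c, h₀, ht, hc⟩ := ih hx
    refine ⟨fun i => if i ≤ t then c i else v, by simpa using h₀, by simp, fun i hi => ?_⟩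
    rcases Nat.lt_succ_iff_lt_or_eq.1 hi with hi | rfl
    · simp only [hi.le, Nat.succ_le_of_lt hi, if_true]
      exact hc i hi
    · simpa [ht] using hxv

theorem _root_.Relation.ReflTransGen.exists_walk (h : Relation.ReflTransGen D.Adj u v) :
    ∃ t, D.Walk t u v := by
  induction h with
  | refl => exact ⟨0, rfl⟩
  | tail _ h ih =>
    obtain ⟨t, ht⟩ := ih
    exact ⟨t + 1, _, ht, h⟩

theorem Walk.reflTransGen (h : D.Walk t u v) : Relation.ReflTransGen D.Adj u v := by
  induction t generalizing v with
  | zero => cases h; rfl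
  | succ t ih =>
    obtain ⟨x, hx, hxv⟩ := h
    exact (ih hx).tail hxv

theorem HasCycleOfLength.exists_walk (h : D.HasCycleOfLength m) : ∃ u, D.Walk m u u := by
  obtain ⟨hm, c, -, hc⟩ := h
  have := walk_of_path (D := D) (t := m) (c := fun i => c ⟨i % m, Nat.mod_lt _ hm⟩) 0 fun j hj => by
    simpa [Nat.add_mod] using hc ⟨(0 + j) % m, Nat.mod_lt _ hm⟩
  exact ⟨_, by simpa using this⟩

/-- Cutting the part between two visits of a vertex out of a walk. -/
theorem exists_walk_split {c : ℕ → V} (hc : ∀ i < t, D.Adj (c i) (c (i + 1))) {i j : ℕ}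
    (hij : i < j) (hj : j ≤ t) (h : c i = c j) :
    D.Walk (j - i) (c i) (c i) ∧ D.Walk (t - (j - i)) (c 0) (c t) := by
  constructor
  · have := walk_of_path (D := D) (c := c) (t := j - i) i fun l hl => hc _ (by omega)
    rwa [Nat.add_sub_cancel' hij.le, ← h] at this
  · have h₁ := walk_of_path (D := D) (c := c) (t := i) 0 fun l hl => hc _ (by omega)
    have h₂ := walk_of_path (D := D) (c := c) (t := t - j) j fun l hl => hc _ (by omega)
    rw [zero_add, h] at h₁
    rw [Nat.add_sub_cancel' hj] at h₂
    have := h₁.add h₂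
    rwa [show i + (t - j) = t - (j - i) by omega] at this

/-- A closed walk without repeated vertices is a cycle; otherwise it splits at a repetition into two
shorter closed walks, and the lengths add up. -/
theorem Walk.dvd_of_forall_cycle (hk : ∀ m, D.HasCycleOfLength m → k ∣ m) (h : D.Walk t u u) :
    k ∣ t := by
  induction t using Nat.strong_induction_on generalizing u with
  | _ t ih =>
    rcases Nat.eq_zero_or_pos t with rfl | ht
    · exact dvd_zero k
    obtain ⟨c, h₀, h₁, hc⟩ := h.exists_path
    by_cases hinj : Function.Injective fun i : Fin t => c i
    · refine hk t ⟨ht, fun i => c i, hinj, fun i => ?_⟩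
      have hi := hc i i.2
      rcases Nat.lt_or_ge (i + 1) t with hlt | hge
      · simpa [Nat.mod_eq_of_lt hlt] using hi
      · have : (i : ℕ) + 1 = t := by omega
        rw [this, h₁, ← h₀] at hi
        simpa [this] using hi
    · simp only [Function.Injective, not_forall] at hinj
      obtain ⟨i, j, hij, hne⟩ := hinj
      wlog hlt : (i : ℕ) < j generalizing i j
      · exact this j i hij.symm (Ne.symm hne) (by
          have := Fin.val_ne_of_ne hne
          omega)
      obtain ⟨h₂, h₃⟩ := exists_walk_split hc hlt j.2.le hij
      rw [h₀, h₁] at h₃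
      have := dvd_add (ih _ (by omega) h₂) (ih _ (by omega) h₃)
      rwa [Nat.add_sub_cancel' (by omega)] at this

theorem Walk.exists_cycle (h : D.Walk t u u) (ht : 0 < t) : ∃ m, D.HasCycleOfLength m := by
  by_contra hne
  push Not at hne
  -- Without cycles every number divides all cycle lengths, in particular `t + 1`, which cannot
  -- divide the positive number `t`.
  have := Walk.dvd_of_forall_cycle (k := t + 1) (fun m hm => (hne m hm).elim) h
  exact absurd (Nat.le_of_dvd ht this) (by omega)

theorem Walk.exists_le_card {n : ℕ} {D : Digraph (Fin n)} {u v : Fin n} (h : D.Walk t u v)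
    (ht : 0 < t) : ∃ t', 0 < t' ∧ t' ≤ n ∧ D.Walk t' u v := by
  induction t using Nat.strong_induction_on with
  | _ t ih =>
    rcases Nat.lt_or_ge n t with hnt | hnt
    · obtain ⟨c, h₀, h₁, hc⟩ := h.exists_path
      -- The repetition is sought among the positions 1 to `t` only. The part cut out is then
      -- shorter than `t`, and the remaining walk keeps a positive length even if it is closed.
      obtain ⟨i, j, hne, hij⟩ := Fintype.exists_ne_map_eq_of_card_lt
        (fun i : Fin t => c (i + 1)) (by simpa using hnt)
      wlog hlt : (i : ℕ) < j generalizing i j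
      · exact this j i hne.symm hij.symm (by
          have := Fin.val_ne_of_ne hne
          omega)
      obtain ⟨-, h₃⟩ := exists_walk_split hc (Nat.add_lt_add_right hlt 1) (by omega) hij
      rw [h₀, h₁] at h₃
      exact ih _ (by omega) h₃ (by omega)
    · exact ⟨t, ht, hnt, h⟩

theorem HasCycleOfLength.le_card {n : ℕ} {D : Digraph (Fin n)} (h : D.HasCycleOfLength m) :
    m ≤ n := by
  obtain ⟨-, c, hc, -⟩ := h
  simpa using Fintype.card_le_of_injective c hc

/-- The bound on `k` rules out the default value 1 of an acyclic digraph. -/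
theorem dvd_cyclicityIndex_iff {n : ℕ} {D : Digraph (Fin n)} (hk : 2 ≤ k) :
    k ∣ D.cyclicityIndex ↔
      (∃ m, D.HasCycleOfLength m) ∧ ∀ m, D.HasCycleOfLength m → k ∣ m := by
  unfold cyclicityIndex
  split_ifs with h
  · rw [Finset.dvd_gcd_iff]
    simp only [Finset.mem_filter, Finset.mem_Icc, id, h, true_and]
    exact ⟨fun H m hm => H m ⟨⟨hm.1, hm.le_card⟩, hm⟩, fun H m hm => H m hm.2⟩
  · simp only [h, false_and, iff_false]
    intro h₁
    have := Nat.le_of_dvd one_pos h₁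
    omega

theorem IsStronglyConnected.exists_walk (h : D.IsStronglyConnected) (hc : ∃ m, D.HasCycleOfLength m)
    (u v : V) : ∃ t, 0 < t ∧ D.Walk t u v := by
  obtain ⟨m, hm⟩ := hc
  obtain ⟨x, hx⟩ := hm.exists_walk
  obtain ⟨a, ha⟩ := (h u x).exists_walk
  obtain ⟨b, hb⟩ := (h x v).exists_walk
  exact ⟨a + m + b, by have := hm.1; omega, (ha.add hx).add hb⟩

/-- A condition on short walks which says that a digraph is strongly connected and that `k`
divides its index of cyclicity. -/
def WalkCondition {n : ℕ} (D : Digraph (Fin n)) (N k : ℕ) : Prop :=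
  n ≠ 0 ∧ ∀ r : Fin n, (∀ v, ∃ t < N, D.Walk (t + 1) r v) ∧ ∀ t < N, D.Walk (t + 1) r r → k ∣ t + 1

/-- Cycles have length at most `n`, and walks of positive length can be shortened to length at most
`n`, so nothing is lost by looking at lengths up to `N`. Because only positive lengths count and `n
≠ 0`, the reachability clause also provides a cycle. -/
theorem walkCondition_iff {n N : ℕ} {D : Digraph (Fin n)} (hN : n ≤ N) (hk : 2 ≤ k) :
    D.WalkCondition N k ↔ D.IsStronglyConnected ∧ k ∣ D.cyclicityIndex := by
  rw [dvd_cyclicityIndex_iff hk]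
  constructor
  · rintro ⟨hn, h⟩
    refine ⟨fun u v => ?_, ?_, fun m hm => ?_⟩
    · obtain ⟨t, -, ht⟩ := (h u).1 v
      exact ht.reflTransGen
    · obtain ⟨t, -, ht⟩ := (h ⟨0, by omega⟩).1 ⟨0, by omega⟩
      exact ht.exists_cycle (by omega)
    · obtain ⟨u, hu⟩ := hm.exists_walk
      obtain ⟨m, rfl⟩ : ∃ m', m = m' + 1 := ⟨m - 1, by have := hm.1; omega⟩
      exact (h u).2 m (by have := hm.le_card; omega) hu
  · rintro ⟨hs, hc, hd⟩
    refine ⟨?_, fun r => ⟨fun v => ?_, fun t _ h => h.dvd_of_forall_cycle hd⟩⟩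
    · obtain ⟨m, hm⟩ := hc
      have := hm.1
      have := hm.le_card
      omega
    · obtain ⟨t, ht, h⟩ := hs.exists_walk hc r v
      obtain ⟨t, ht, hn, h⟩ := h.exists_le_card ht
      obtain ⟨t, rfl⟩ : ∃ t', t = t' + 1 := ⟨t - 1, by omega⟩
      exact ⟨t, by omega, h⟩

end Digraph

/-! ### Limit cycles of conjunctive networks -/

namespace GlobalFunction

variable {n k : ℕ} {f : GlobalFunction n}

/-- The set in the definition of a conjunctive function is forced to be the in-neighbourhood:
flipping one of its members in the all-ones configuration changes the value, and flipping any other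
coordinate never does. -/
theorem IsConjunctive.eq_false_iff (hf : f.IsConjunctive) (x : Config n) (v : Fin n) :
    f x v = false ↔ ∃ u, f.interactionDigraph.Adj u v ∧ x u = false := by
  obtain ⟨I, hI⟩ := hf v
  have key : ∀ u, f.interactionDigraph.Adj u v ↔ u ∈ I := by
    intro u
    constructor
    · rintro ⟨y, hy⟩
      by_contra hu
      apply hy
      rw [Bool.eq_iff_iff, ← not_iff_not, Bool.not_eq_true, Bool.not_eq_true, hI, hI]
      refine exists_congr fun w => and_congr_right fun hw => ?_
      rw [Function.update_of_ne (fun e : w = u => hu (e ▸ hw))]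
    · intro hu
      refine ⟨fun _ => true, ?_⟩
      have h₁ : f (fun _ => true) v ≠ false := by simp [hI]
      have h₂ : f (Function.update (fun _ => true) u (!true)) v = false :=
        (hI _).2 ⟨u, hu, by simp⟩
      rw [h₂]
      exact h₁
  simp only [hI, key]

theorem IsConjunctive.iterate_eq_false_iff (hf : f.IsConjunctive) (t : ℕ) (x : Config n)
    (v : Fin n) : f^[t] x v = false ↔ ∃ u, f.interactionDigraph.Walk t u v ∧ x u = false := by
  induction t generalizing v with
  | zero => simp [Digraph.Walk]
  | succ t ih =>
    rw [Function.iterate_succ_apply', hf.eq_false_iff]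
    simp only [ih, Digraph.Walk]
    constructor
    · rintro ⟨u, hu, w, hw, hx⟩
      exact ⟨w, ⟨u, hw, hu⟩, hx⟩
    · rintro ⟨w, ⟨u, hw, hu⟩, hx⟩
      exact ⟨u, hu, w, hw, hx⟩

/-- The orbit is extended periodically to a sequence `y` on ℕ. Zeros persist along closed walks
(`mono`), and by periodicity this is reversible (`period`), so the length of a closed walk at `v` is
a period of the coordinate `v`. Comparing two closed walks then gives the period `m`, and
distinctness of the configurations turns it into `k ∣ m`. -/
theorem IsLimitCycle.dvd_cyclicityIndex (hf : f.IsConjunctive)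
    (hs : f.interactionDigraph.IsStronglyConnected) {c : Fin k → Config n}
    (hc : f.IsLimitCycle c) : k ∣ f.interactionDigraph.cyclicityIndex := by
  obtain ⟨hk, hinj, hc⟩ := hc
  set y : ℕ → Config n := fun i => c ⟨i % k, Nat.mod_lt _ (by omega)⟩ with hy
  have hy₁ : ∀ i, f (y i) = y (i + 1) := fun i => by
    simp only [hy, hc, Nat.mod_add_mod]
  have hyt : ∀ t i, f^[t] (y i) = y (i + t) := by
    intro t i
    induction t with
    | zero => rfl
    | succ t ih => rw [Function.iterate_succ_apply', ih, hy₁, add_assoc]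
  have hyk : ∀ i j, y (i + j * k) = y i := fun i j => by simp [hy]
  have hdvd : ∀ i, y i = y 0 → k ∣ i := fun i h => by
    have := hinj h
    simpa [Nat.dvd_iff_mod_eq_zero] using this
  have mono : ∀ v L, f.interactionDigraph.Walk L v v → ∀ i j, y i v = false →
      y (i + j * L) v = false := by
    intro v L hL i j h
    induction j with
    | zero => simpa using h
    | succ j ih =>
      rw [add_mul, one_mul, ← add_assoc, ← hyt, hf.iterate_eq_false_iff]
      exact ⟨v, hL, ih⟩
  have period : ∀ v L, f.interactionDigraph.Walk L v v → ∀ i, y (i + L) v = y i v := by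
    intro v L hL i
    rw [Bool.eq_iff_iff, ← not_iff_not, Bool.not_eq_true, Bool.not_eq_true]
    refine ⟨fun h => ?_, fun h => by simpa using mono v L hL i 1 h⟩
    -- After `k - 1` more turns the total shift is `L * k`, a multiple of the period.
    have := mono v L hL (i + L) (k - 1) h
    rwa [add_assoc, show L + (k - 1) * L = L * k by
      rw [Nat.sub_mul, one_mul, mul_comm L k]
      exact Nat.add_sub_cancel' (Nat.le_mul_of_pos_left _ (by omega)), hyk] at this
  rw [Digraph.dvd_cyclicityIndex_iff hk]
  constructor
  · by_contra hne
    have hna : ∀ u v, ¬ f.interactionDigraph.Adj u v := fun u v huv => by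
      obtain ⟨t, ht⟩ := (hs v u).exists_walk
      exact hne (((Digraph.walk_one.2 huv).add ht).exists_cycle (by omega))
    -- Without arcs `f` is constantly 1, and `y 0` is itself a value of `f`; hence the orbit is a
    -- fixed point, against `2 ≤ k`.
    have : y (0 + 1) = y 0 := by
      have h : ∀ i v, y (i + 1) v = true := fun i v => by
        rw [← hy₁, ← Bool.not_eq_false, hf.eq_false_iff]
        simp [hna]
      have h₀ : y 0 = y (k - 1 + 1) := by
        rw [← hyk 0 1]
        congr 1
        omega
      funext v
      rw [h₀, h, h]
    have := Nat.le_of_dvd (by omega) (hdvd _ this)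
    omega
  · intro m hm
    refine hdvd m ?_
    obtain ⟨u, hu⟩ := hm.exists_walk
    funext v
    obtain ⟨a, ha⟩ := (hs v u).exists_walk
    obtain ⟨b, hb⟩ := (hs u v).exists_walk
    -- Both `a + b` and `a + m + b` are periods at `v`, and `m + (a + b) = 0 + (a + m + b)`.
    rw [← period v _ (ha.add hb) m, ← period v _ ((ha.add hu).add hb) 0]
    congr 1
    ring

/-- The class of `v` is the length modulo `k` of any walk from `r` to `v`. Every arc raises the
class by one and every vertex has an in-neighbour, so `f` carries the configuration with zeros on
class `i` to the one with zeros on class `i + 1`. -/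
theorem IsConjunctive.exists_limitCycle (hf : f.IsConjunctive)
    (hs : f.interactionDigraph.IsStronglyConnected) (hk : 2 ≤ k)
    (hd : k ∣ f.interactionDigraph.cyclicityIndex) : ∃ c : Fin k → Config n, f.IsLimitCycle c := by
  classical
  obtain ⟨hcyc, hd⟩ := (Digraph.dvd_cyclicityIndex_iff hk).1 hd
  have hpos := hs.exists_walk hcyc
  obtain ⟨m, hm⟩ := hcyc
  obtain ⟨r, -⟩ := hm.exists_walk
  choose d hdw using fun v => (hs r v).exists_walk
  have hmod : ∀ t v, f.interactionDigraph.Walk t r v → (t : ZMod k) = d v := by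
    intro t v h
    obtain ⟨b, hb⟩ := (hs v r).exists_walk
    have h₁ := (h.add hb).dvd_of_forall_cycle hd
    -- Two walks from `r` to `v`, completed by the same way back, are closed walks; so their lengths
    -- agree modulo `k`.
    have h₂ := ((hdw v).add hb).dvd_of_forall_cycle hd
    rw [← ZMod.natCast_eq_zero_iff, Nat.cast_add] at h₁ h₂
    exact add_right_cancel (h₁.trans h₂.symm)
  have hadj : ∀ u v, f.interactionDigraph.Adj u v → (d v : ZMod k) = d u + 1 := by
    intro u v h
    rw [← hmod _ _ ((hdw u).add (Digraph.walk_one.2 h)), Nat.cast_add, Nat.cast_one]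
  have hin : ∀ v, ∃ u, f.interactionDigraph.Adj u v := by
    intro v
    obtain ⟨t, ht, h⟩ := hpos v v
    obtain ⟨t, rfl⟩ : ∃ t', t = t' + 1 := ⟨t - 1, by omega⟩
    obtain ⟨u, -, hu⟩ := h
    exact ⟨u, hu⟩
  have hwalk : ∀ t : ℕ, ∃ v, f.interactionDigraph.Walk t r v := by
    intro t
    induction t with
    | zero => exact ⟨r, rfl⟩
    | succ t ih =>
      obtain ⟨v, hv⟩ := ih
      obtain ⟨s, hs, h⟩ := hpos v v
      obtain ⟨c, h₀, -, hc⟩ := h.exists_path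
      exact ⟨c 1, v, hv, h₀ ▸ hc 0 hs⟩
  refine ⟨fun i v => decide ((d v : ZMod k) ≠ ((i : ℕ) : ZMod k)), by omega, ?_, fun i => ?_⟩
  · intro i j hij
    -- No class is empty: the end of a walk of length `i` lies in class `i`. It is a zero of both
    -- configurations, which forces the classes to agree.
    obtain ⟨v, hv⟩ := hwalk i
    have := congrFun hij v
    have h : ((i : ℕ) : ZMod k) = ((j : ℕ) : ZMod k) := by
      simpa [← hmod _ _ hv] using this
    rw [ZMod.natCast_eq_natCast_iff'] at h
    rw [Nat.mod_eq_of_lt i.2, Nat.mod_eq_of_lt j.2] at h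
    exact Fin.ext h
  · funext v
    rw [Bool.eq_iff_iff, ← not_iff_not, Bool.not_eq_true, Bool.not_eq_true, hf.eq_false_iff]
    simp only [ne_eq, decide_not, Bool.not_eq_false', decide_eq_true_eq, ZMod.natCast_mod,
      Nat.cast_add, Nat.cast_one]
    constructor
    · rintro ⟨u, hu, hi⟩
      rw [hadj u v hu, hi]
    · intro hv
      obtain ⟨u, hu⟩ := hin v
      exact ⟨u, hu, add_right_cancel ((hadj u v hu).symm.trans hv)⟩

theorem IsConjunctive.limitCycleConfigs_nonempty_iff (hk : 2 ≤ k) (hf : f.IsConjunctive)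
    (hs : f.interactionDigraph.IsStronglyConnected) :
    (f.limitCycleConfigs k).Nonempty ↔ k ∣ f.interactionDigraph.cyclicityIndex := by
  constructor
  · rintro ⟨x, c, hc, -⟩
    exact hc.dvd_cyclicityIndex hf hs
  · intro h
    obtain ⟨c, hc⟩ := hf.exists_limitCycle hs hk h
    exact ⟨c ⟨0, by omega⟩, c, hc, _, rfl⟩

/-- The conjunctive network with a given interaction digraph. -/
theorem exists_isConjunctive (D : Digraph (Fin n)) :
    ∃ f : GlobalFunction n, f.IsConjunctive ∧ f.interactionDigraph = D := by
  classical
  have hf : GlobalFunction.IsConjunctive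
      (fun (x : Config n) v => decide (∀ u, D.Adj u v → x u = true)) :=
    fun v => ⟨{u | D.Adj u v}, fun x => by simp⟩
  refine ⟨_, hf, ?_⟩
  ext u v
  have h := hf.eq_false_iff (Function.update (fun _ => true) u false) v
  simp only [decide_eq_false_iff_not, Function.update_apply] at h
  simp at h
  exact h.symm

end GlobalFunction

/-! ### Reasoning about programs -/

namespace Store

variable {C A : Type}

/-- The bit at position `i` of the array `a`. -/
def bit (s : Store C A) (a : A) (i : ℕ) : Prop := (s.arr a).getD i false = true

instance (s : Store C A) (a : A) (i : ℕ) : Decidable (s.bit a i) :=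
  inferInstanceAs (Decidable (_ = true))

section

variable [DecidableEq C] (s : Store C A) (x y : C) (n : ℕ) (a : A) (i : ℕ)

@[simp] theorem cnt_setCnt : (s.setCnt x n).cnt y = if y = x then n else s.cnt y := by
  simp [setCnt, Function.update_apply]

@[simp] theorem arr_setCnt : (s.setCnt x n).arr a = s.arr a := rfl

@[simp] theorem bit_setCnt : (s.setCnt x n).bit a i ↔ s.bit a i := Iff.rfl

end

section

variable [DecidableEq A] (s : Store C A) (x : C) (a b : A) (l : List Bool) (i : ℕ)

@[simp] theorem cnt_setArr : (s.setArr a l).cnt x = s.cnt x := rfl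

@[simp] theorem arr_setArr : (s.setArr a l).arr b = if b = a then l else s.arr b := by
  simp [setArr, Function.update_apply]

theorem bit_setArr_of_ne {a b : A} (h : b ≠ a) : (s.setArr a l).bit b i ↔ s.bit b i := by
  simp [bit, h]

theorem bit_setArr_set {a : A} {i j : ℕ} (c : Bool) (h : i < (s.arr a).length) :
    (s.setArr a ((s.arr a).set i c)).bit a j ↔ if j = i then c = true else s.bit a j := by
  simp only [bit, arr_setArr, if_true, List.getD_eq_getElem?_getD, List.getElem?_set]
  by_cases hj : j = i
  · subst hj
    simp [h]
  · rw [if_neg (Ne.symm hj), if_neg hj]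

end

end Store

namespace Cmd

variable {C A T : Type} [DecidableEq C] [DecidableEq A]

/-- The program does not act on the counter `x`. -/
def keepsCnt (x : C) : Cmd C A T → Bool
  | inc y => y ≠ x
  | dec y => y ≠ x
  | zero y => y ≠ x
  | seq p q => p.keepsCnt x && q.keepsCnt x
  | ifEq _ _ p q => p.keepsCnt x && q.keepsCnt x
  | ifBit _ _ p q => p.keepsCnt x && q.keepsCnt x
  | loop _ p => p.keepsCnt x
  | _ => true

/-- The program does not act on the array `a`. -/
def keepsArr (a : A) : Cmd C A T → Bool
  | set b _ _ => b ≠ a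
  | cons b _ => b ≠ a
  | nil b => b ≠ a
  | seq p q => p.keepsArr a && q.keepsArr a
  | ifEq _ _ p q => p.keepsArr a && q.keepsArr a
  | ifBit _ _ p q => p.keepsArr a && q.keepsArr a
  | loop _ p => p.keepsArr a
  | _ => true

/-- The stores `s` and `s'` agree on everything that `p` does not act on. -/
def Frame (p : Cmd C A T) (s s' : Store C A) : Prop :=
  (∀ x, p.keepsCnt x = true → s'.cnt x = s.cnt x) ∧ ∀ a, p.keepsArr a = true → s'.arr a = s.arr a

variable {p q body : Cmd C A T} {N : ℕ} {s s' s'' : Store C A}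

theorem Frame.refl (p : Cmd C A T) (s : Store C A) : p.Frame s s :=
  ⟨fun _ _ => rfl, fun _ _ => rfl⟩

theorem Frame.trans (h : p.Frame s s') (h' : p.Frame s' s'') : p.Frame s s'' :=
  ⟨fun x hx => (h'.1 x hx).trans (h.1 x hx), fun a ha => (h'.2 a ha).trans (h.2 a ha)⟩

/-- For a concrete program `keepsCnt` and `keepsArr` compute to `true`, so that later on a proof
that a counter or an array is unchanged is just `rfl`. -/
theorem frame_eval (p : Cmd C A T) (N : ℕ) (s : Store C A) : p.Frame s (p.eval N s) := by
  induction p generalizing s with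
  | skip => exact Frame.refl _ _
  | inc y | dec y | zero y =>
    refine ⟨fun x hx => ?_, fun _ _ => rfl⟩
    simp only [keepsCnt, ne_eq, decide_not, Bool.not_eq_true', decide_eq_false_iff_not] at hx
    simp [eval, Ne.symm hx]
  | set b y c | cons b c | nil b =>
    refine ⟨fun _ _ => rfl, fun a ha => ?_⟩
    simp only [keepsArr, ne_eq, decide_not, Bool.not_eq_true', decide_eq_false_iff_not] at ha
    simp [eval, Ne.symm ha]
  | seq p q ihp ihq =>
    refine ⟨fun x hx => ?_, fun a ha => ?_⟩
    · simp only [keepsCnt, Bool.and_eq_true] at hx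
      exact ((ihq _).1 x hx.2).trans ((ihp s).1 x hx.1)
    · simp only [keepsArr, Bool.and_eq_true] at ha
      exact ((ihq _).2 a ha.2).trans ((ihp s).2 a ha.1)
  | ifEq _ _ p q ihp ihq | ifBit _ _ p q ihp ihq =>
    refine ⟨fun x hx => ?_, fun a ha => ?_⟩
    · simp only [keepsCnt, Bool.and_eq_true] at hx
      simp only [eval]
      split_ifs
      exacts [(ihp s).1 x hx.1, (ihq s).1 x hx.2]
    · simp only [keepsArr, Bool.and_eq_true] at ha
      simp only [eval]
      split_ifs
      exacts [(ihp s).2 a ha.1, (ihq s).2 a ha.2]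
  | loop t p ih =>
    have key : ∀ i, p.Frame s ((p.eval N)^[i] s) := by
      intro i
      induction i with
      | zero => exact Frame.refl _ _
      | succ i hi =>
        rw [Function.iterate_succ_apply']
        exact hi.trans (ih _)
    exact key N

theorem eval_loop (t : T) (I : ℕ → Store C A → Prop) (h₀ : I 0 s)
    (step : ∀ i s', i < N → body.Frame s s' → I i s' → I (i + 1) (body.eval N s')) :
    I N ((loop t body).eval N s) := by
  have key : ∀ i ≤ N, body.Frame s ((body.eval N)^[i] s) ∧ I i ((body.eval N)^[i] s) := by
    intro i
    induction i with
    | zero => exact fun _ => ⟨Frame.refl _ _, h₀⟩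
    | succ i ih =>
      intro hi
      obtain ⟨h₁, h₂⟩ := ih (by omega)
      rw [Function.iterate_succ_apply']
      exact ⟨h₁.trans (frame_eval _ _ _), step i _ (by omega) h₁ h₂⟩
  exact (key N le_rfl).2

/-- Repeat a program for all values of the counter `i` less than the counter `y`, but at most as
often as the input is long. -/
def forLt (t : T) (i y : C) (p : Cmd C A T) : Cmd C A T :=
  seq (zero i) (loop t (ifEq i y skip (seq p (inc i))))

/-- The loop always makes `N` rounds, but is idle once `i` has reached `y`; the body thus runs `min
(s.cnt y) N` times. This truncation is harmless for vertices and gives saturation in `double`. -/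
theorem eval_forLt (t : T) {i y : C} (I : ℕ → Store C A → Prop) (hy : i ≠ y)
    (hi' : body.keepsCnt i = true) (hy' : body.keepsCnt y = true)
    (h₀ : I 0 (s.setCnt i 0))
    (step : ∀ j s', j < s.cnt y → j < N → s'.cnt i = j → s'.cnt y = s.cnt y →
      (forLt t i y body).Frame s s' → I j s' → I (j + 1) ((body.eval N s').setCnt i (j + 1))) :
    I (min (s.cnt y) N) ((forLt t i y body).eval N s) := by
  have hk : ∀ s', (ifEq i y skip (seq body (inc i))).Frame (s.setCnt i 0) s' →
      (forLt t i y body).Frame s s' := by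
    rintro s' ⟨h₁, h₂⟩
    refine ⟨fun x hx => ?_, fun a ha => ?_⟩
    · simp only [forLt, keepsCnt, Bool.and_eq_true, ne_eq, decide_not, Bool.not_eq_true',
        decide_eq_false_iff_not, true_and] at hx
      rw [h₁ x (by simp [keepsCnt, hx]), Store.cnt_setCnt, if_neg (Ne.symm hx.1)]
    · simp only [forLt, keepsArr, Bool.and_true, Bool.true_and] at ha
      rw [h₂ a (by simp [keepsArr, ha]), Store.arr_setCnt]
  have := eval_loop (N := N) (s := s.setCnt i 0) (body := ifEq i y skip (seq body (inc i))) t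
    (fun l s' => s'.cnt i = min (s.cnt y) l ∧ s'.cnt y = s.cnt y ∧ I (min (s.cnt y) l) s')
    ⟨by simp, by simp [hy.symm], by simpa using h₀⟩ (by
      rintro l s' hl hf ⟨h₁, h₂, h₃⟩
      simp only [eval]
      split_ifs with h
      · rw [h₁, h₂] at h
        rw [show min (s.cnt y) (l + 1) = min (s.cnt y) l by omega]
        exact ⟨h₁, h₂, h₃⟩
      · rw [h₁, h₂] at h
        rw [show min (s.cnt y) (l + 1) = min (s.cnt y) l + 1 by omega]
        have e := (frame_eval body N s').1 i hi'
        refine ⟨by simp [e, h₁], ?_, ?_⟩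
        · simp [hy.symm, (frame_eval body N s').1 y hy', h₂]
        · rw [e, h₁]
          exact step _ _ (by omega) (by omega) h₁ h₂ (hk s' hf) h₃)
  exact this.2.2

/-- Replace an array by as many zeros as the input is long. -/
def alloc (t : T) (a : A) : Cmd C A T := seq (nil a) (loop t (cons a false))

theorem eval_alloc (t : T) (a : A) :
    (alloc t a : Cmd C A T).eval N s = s.setArr a (List.replicate N false) := by
  have := eval_loop (N := N) (s := s.setArr a []) (body := (cons a false : Cmd C A T)) t
    (fun i s' => s' = s.setArr a (List.replicate i false)) rfl (by
      rintro i s' - - rfl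
      simp [eval, Store.setArr, List.replicate_succ])
  exact this

end Cmd

/-! ### The decision procedures -/

namespace PLCE

open Cmd

/-- The counters of the decision procedures. -/
inductive Ctr
  | nought | bad | flag | m | n | k | q | i | r | t | u | v | pos
  deriving DecidableEq

instance : Fintype Ctr :=
  ⟨{.nought, .bad, .flag, .m, .n, .k, .q, .i, .r, .t, .u, .v, .pos}, fun x => by cases x <;> decide⟩

/-- The arrays of the decision procedures. -/
inductive Arr
  | bits | tags | cur | next | seen
  deriving DecidableEq

instance : Fintype Arr := ⟨{.bits, .tags, .cur, .next, .seen}, fun x => by cases x <;> decide⟩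

/-- The type of the decision procedures. -/
abbrev Procedure : Type := Cmd Ctr Arr (Fin 4)

/-- Compute the square of the counter `n`. -/
def square : Procedure := seq (zero .q) (forLt 1 .u .n (forLt 2 .v .n (inc .q)))

/-- Compute the square root of the counter `m`, and reject if it is not an integer. -/
def squareRoot : Procedure :=
  seq (zero .n) <| seq (loop 0 (seq square (ifEq .q .m skip (inc .n)))) <|
    seq square (ifEq .q .m skip (inc .bad))

/-- Compute the characteristic function of the set of the heads of the arcs with tail in the set
whose characteristic function is `cur`. -/
def image : Procedure :=
  seq (alloc 2 .next) <| seq (zero .pos) <| forLt 2 .u .n <| forLt 3 .v .n <|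
    seq (ifBit .bits .pos (ifBit .cur .u (set .next .v true) skip) skip) (inc .pos)

/-- Copy the array `next` to `cur`, and add it to `seen`. -/
def update : Procedure :=
  forLt 2 .v .n (ifBit .next .v (seq (set .cur .v true) (set .seen .v true)) (set .cur .v false))

/-- Follow the walks that start in the vertex `r`, and check that they reach all vertices and that the
lengths of closed walks are multiples of the counter `k`. -/
def checkVertex : Procedure :=
  seq (alloc 1 .cur) <| seq (set .cur .r true) <| seq (alloc 1 .seen) <| seq (zero .t) <|
  seq (loop 1 <| seq image <| seq update <| seq (inc .t) <| seq (ifEq .t .k (zero .t) skip) <|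
    ifBit .cur .r (ifEq .t .nought skip (inc .bad)) skip) <|
  forLt 1 .v .n (ifBit .seen .v skip (inc .bad))

/-- Check all vertices. -/
def checkDigraph : Procedure :=
  seq (ifEq .n .nought (inc .bad) skip) (forLt 0 .r .n checkVertex)

variable {N : ℕ} {s : Store Ctr Arr}

theorem cnt_eval_square (h : s.cnt .n ≤ N) : (square.eval N s).cnt .q = s.cnt .n * s.cnt .n := by
  have := eval_forLt (N := N) (s := s.setCnt .q 0) (body := (forLt 2 .v .n (inc .q) : Procedure))
    1 (i := .u) (y := .n) (fun j s' => s'.cnt .q = j * s.cnt .n) (by decide) rfl rfl (by simp)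
    (by
      intro j s' hj _ _ hn _ hq
      have := eval_forLt (N := N) (s := s') (body := (inc .q : Procedure))
        2 (i := .v) (y := .n) (fun l s'' => s''.cnt .q = j * s.cnt .n + l) (by decide) rfl rfl
        (by simpa using hq) (by
          intro l s'' _ _ _ _ _ hq'
          simp [eval, hq', add_assoc])
      rw [hn] at this
      simp only [Store.cnt_setCnt, reduceCtorEq, if_false] at this ⊢
      rw [this, min_eq_left h]
      ring)
  simpa [h, square, eval] using this

theorem cnt_eval_squareRoot (h : s.cnt .m ≤ N) :
    (squareRoot.eval N s).cnt .n ≤ N ∧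
    ((∃ n, n * n = s.cnt .m) → (squareRoot.eval N s).cnt .n * (squareRoot.eval N s).cnt .n =
      s.cnt .m) ∧
    ((squareRoot.eval N s).cnt .bad = 0 ↔ s.cnt .bad = 0 ∧
      (squareRoot.eval N s).cnt .n * (squareRoot.eval N s).cnt .n = s.cnt .m) := by
  have h₁ := eval_loop (N := N) (s := s.setCnt .n 0)
    (body := (seq square (ifEq .q .m skip (inc .n)) : Procedure)) 0
    -- Linear search: the counter has stopped at a root, or it has advanced in each round and all
    -- smaller candidates have failed.
    (fun i s' => s'.cnt .n ≤ i ∧ (s'.cnt .n * s'.cnt .n = s.cnt .m ∨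
      s'.cnt .n = i ∧ ∀ j < i, j * j ≠ s.cnt .m)) (by simp) (by
      rintro i s' hi hf ⟨hn, hs'⟩
      have hq := cnt_eval_square (N := N) (s := s') (by omega)
      have hm : (square.eval N s').cnt .m = s.cnt .m :=
        ((frame_eval square N s').1 .m rfl).trans (hf.1 .m rfl)
      have hn' : (square.eval N s').cnt .n = s'.cnt .n := (frame_eval square N s').1 .n rfl
      simp only [eval, hq, hm]
      split_ifs with hsq
      · rw [hn']
        exact ⟨by omega, .inl hsq⟩
      · simp only [Store.cnt_setCnt, if_true, hn']
        refine ⟨by omega, .inr ?_⟩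
        obtain ⟨h₁, h₂⟩ := hs'.resolve_left hsq
        refine ⟨by rw [h₁], fun j hj => ?_⟩
        rcases Nat.lt_succ_iff_lt_or_eq.1 hj with hj | rfl
        · exact h₂ j hj
        · rwa [h₁] at hsq)
  set s₁ := (loop 0 (seq square (ifEq .q .m skip (inc .n))) : Procedure).eval N (s.setCnt .n 0)
    with hs₁
  have hf₁ : s₁.cnt .m = s.cnt .m := (frame_eval (loop 0 (seq square (ifEq .q .m skip (inc .n))) :
    Procedure) N (s.setCnt .n 0)).1 .m rfl
  have hb₁ : s₁.cnt .bad = s.cnt .bad := (frame_eval (loop 0 (seq square (ifEq .q .m skip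
    (inc .n))) : Procedure) N (s.setCnt .n 0)).1 .bad rfl
  have hq := cnt_eval_square (N := N) (s := s₁) h₁.1
  have hm : (square.eval N s₁).cnt .m = s.cnt .m := ((frame_eval square N s₁).1 .m rfl).trans hf₁
  have hb : (square.eval N s₁).cnt .bad = s.cnt .bad :=
    ((frame_eval square N s₁).1 .bad rfl).trans hb₁
  have hn : (square.eval N s₁).cnt .n = s₁.cnt .n := (frame_eval square N s₁).1 .n rfl
  have e : squareRoot.eval N s = if s₁.cnt .n * s₁.cnt .n = s.cnt .m then square.eval N s₁ else
      (square.eval N s₁).setCnt .bad (s.cnt .bad + 1) := by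
    rw [← hq, ← hm, ← hb]
    rfl
  have hn' : (squareRoot.eval N s).cnt .n = s₁.cnt .n := by
    rw [e]
    split_ifs <;> simp [hn]
  rw [hn']
  refine ⟨h₁.1, ?_, ?_⟩
  · rintro ⟨n, hn⟩
    rcases h₁.2 with h₂ | ⟨h₂, h₃⟩
    · exact h₂
    -- The rounds exclude only roots below `N`. If the root is `N` itself, the counter has just
    -- arrived there.
    · have hnN : n ≤ N := by nlinarith
      rcases hnN.lt_or_eq with hlt | rfl
      · exact (h₃ n hlt hn).elim
      · rw [h₂]; assumption
  · rw [e]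
    split_ifs with hsq
    · simp [hb, hsq]
    · simp [hsq]

end PLCE

/-! ### Correctness of the propagation along walks. -/

namespace PLCE

open Cmd

variable {N : ℕ} {s : Store Ctr Arr}

theorem not_bit_alloc {C A : Type} [DecidableEq A] (s : Store C A) (a : A) (N i : ℕ) :
    ¬ (s.setArr a (List.replicate N false)).bit a i := by
  simp [Store.bit, List.getD_eq_getElem?_getD, List.getElem?_replicate]
  split_ifs <;> simp

/-- The counter `pos` runs through the matrix in step with the two loops, so the index `j * n + v`
never has to be computed. -/
theorem eval_image_inner {j : ℕ} (hn : s.cnt .n ≤ N) (hu : s.cnt .u = j)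
    (hpos : s.cnt .pos = j * s.cnt .n) (hl : (s.arr .next).length = N) :
    let s' := (forLt 3 .v .n (seq (ifBit .bits .pos (ifBit .cur .u (set .next .v true) skip) skip)
      (inc .pos)) : Procedure).eval N s
    s'.cnt .pos = (j + 1) * s.cnt .n ∧ (s'.arr .next).length = N ∧
      ∀ v < s.cnt .n, s'.bit .next v ↔
        s.bit .next v ∨ s.bit .cur j ∧ s.bit .bits (j * s.cnt .n + v) := by
  have := eval_forLt (N := N) (s := s) (body := (seq (ifBit .bits .pos (ifBit .cur .u
    (set .next .v true) skip) skip) (inc .pos) : Procedure)) 3 (i := .v) (y := .n)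
    (fun l s' => s'.cnt .pos = j * s.cnt .n + l ∧ (s'.arr .next).length = N ∧
      ∀ v < s.cnt .n, s'.bit .next v ↔
        s.bit .next v ∨ v < l ∧ s.bit .cur j ∧ s.bit .bits (j * s.cnt .n + v))
    (by decide) rfl rfl (by simp [hpos, hl]) (by
      rintro l s' hl - hv - hf ⟨h₁, h₂, h₃⟩
      have hu' : s'.cnt .u = j := (hf.1 .u rfl).trans hu
      have hbits : (s'.arr .bits).getD (s'.cnt .pos) false = true ↔
          s.bit .bits (j * s.cnt .n + l) := by
        rw [hf.2 .bits rfl, h₁]; rfl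
      have hcur : (s'.arr .cur).getD (s'.cnt .u) false = true ↔ s.bit .cur j := by
        rw [hf.2 .cur rfl, hu']; rfl
      simp only [eval, hbits, hcur]
      split_ifs with hb hc
      · refine ⟨by simp [h₁, add_assoc], by simp [h₂], fun v hv' => ?_⟩
        rw [Store.bit_setCnt, Store.bit_setCnt, Store.bit_setArr_set _ _ (by omega), hv, h₃ v hv']
        by_cases h : v = l
        · subst h; simp [hb, hc]
        · simp only [h, if_false, show v < l + 1 ↔ v < l by omega]
      all_goals
        refine ⟨by simp [h₁, add_assoc], by simp [h₂], fun v hv' => ?_⟩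
        rw [Store.bit_setCnt, Store.bit_setCnt, h₃ v hv']
        by_cases h : v = l
        · subst h; simp_all
        · simp only [show v < l + 1 ↔ v < l by omega])
  rw [min_eq_left hn] at this
  refine ⟨by rw [this.1]; ring, this.2.1, fun v hv => ?_⟩
  rw [this.2.2 v hv]
  simp [hv]

theorem eval_image (hn : s.cnt .n ≤ N) :
    ((image.eval N s).arr .next).length = N ∧ ∀ v < s.cnt .n, (image.eval N s).bit .next v ↔
      ∃ u < s.cnt .n, s.bit .cur u ∧ s.bit .bits (u * s.cnt .n + v) := by
  set s₀ := (s.setArr .next (List.replicate N false)).setCnt .pos 0 with hs₀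
  have e : image.eval N s = (forLt 2 .u .n (forLt 3 .v .n (seq (ifBit .bits .pos (ifBit .cur .u
      (set .next .v true) skip) skip) (inc .pos))) : Procedure).eval N s₀ := by
    rw [image, eval, eval, eval_alloc]
    rfl
  have hn₀ : s₀.cnt .n = s.cnt .n := by simp [hs₀]
  have := eval_forLt (N := N) (s := s₀) (body := (forLt 3 .v .n (seq (ifBit .bits .pos
    (ifBit .cur .u (set .next .v true) skip) skip) (inc .pos)) : Procedure)) 2 (i := .u) (y := .n)
    (fun j s' => s'.cnt .pos = j * s.cnt .n ∧ (s'.arr .next).length = N ∧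
      ∀ v < s.cnt .n, s'.bit .next v ↔
        ∃ u < j, s.bit .cur u ∧ s.bit .bits (u * s.cnt .n + v))
    (by decide) rfl rfl (by
      refine ⟨by simp [hs₀], by simp [hs₀], fun v _ => ?_⟩
      rw [Store.bit_setCnt, hs₀, Store.bit_setCnt]
      simp [not_bit_alloc]) (by
      rintro j s' hj - hu hn' hf ⟨h₁, h₂, h₃⟩
      have hn'' : s'.cnt .n = s.cnt .n := hn'.trans hn₀
      have hcur : s'.arr .cur = s.arr .cur := by
        rw [hf.2 .cur rfl]; simp [hs₀]
      have hbits : s'.arr .bits = s.arr .bits := by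
        rw [hf.2 .bits rfl]; simp [hs₀]
      obtain ⟨h₄, h₅, h₆⟩ := eval_image_inner (N := N) (s := s') (j := j) (by omega) hu
        (by rw [h₁, hn'']) h₂
      rw [hn''] at h₄ h₆
      refine ⟨by simp [h₄], by simpa using h₅, fun v hv => ?_⟩
      rw [Store.bit_setCnt, h₆ v hv, h₃ v hv]
      simp only [Store.bit, hcur, hbits]
      constructor
      · rintro (⟨u, hu, h⟩ | h)
        · exact ⟨u, by omega, h⟩
        · exact ⟨j, by omega, h⟩
      · rintro ⟨u, hu, h⟩
        rcases Nat.lt_succ_iff_lt_or_eq.1 hu with hu | rfl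
        · exact .inl ⟨u, hu, h⟩
        · exact .inr h)
  rw [hn₀, min_eq_left hn] at this
  rw [e]
  exact this.2

theorem eval_update (hn : s.cnt .n ≤ N) (hcur : (s.arr .cur).length = N)
    (hseen : (s.arr .seen).length = N) :
    ((update.eval N s).arr .cur).length = N ∧ ((update.eval N s).arr .seen).length = N ∧
    (∀ v < s.cnt .n, (update.eval N s).bit .cur v ↔ s.bit .next v) ∧
    ∀ v < s.cnt .n, (update.eval N s).bit .seen v ↔ s.bit .seen v ∨ s.bit .next v := by
  have := eval_forLt (N := N) (s := s) (body := (ifBit .next .v (seq (set .cur .v true)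
    (set .seen .v true)) (set .cur .v false) : Procedure)) 2 (i := .v) (y := .n)
    (fun l s' => (s'.arr .cur).length = N ∧ (s'.arr .seen).length = N ∧
      (∀ v < l, s'.bit .cur v ↔ s.bit .next v) ∧
      ∀ v < s.cnt .n, s'.bit .seen v ↔ s.bit .seen v ∨ v < l ∧ s.bit .next v)
    (by decide) rfl rfl (by simp [hcur, hseen]) (by
      rintro l s' hl hlN hv - hf ⟨h₁, h₂, h₃, h₄⟩
      have hnext : (s'.arr .next).getD (s'.cnt .v) false = true ↔ s.bit .next l := by
        rw [hf.2 .next rfl, hv]; rfl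
      simp only [eval, hnext]
      split_ifs with h
      · refine ⟨by simp [h₁], by simp [h₂], fun v hv' => ?_, fun v hv' => ?_⟩
        · rw [Store.bit_setCnt, Store.bit_setArr_of_ne _ _ _ (by decide),
            Store.bit_setArr_set _ _ (by omega), hv]
          by_cases hvl : v = l
          · subst hvl; simp [h]
          · simp [hvl, h₃ v (by omega)]
        · rw [Store.bit_setCnt, Store.bit_setArr_set _ _ (by simp; omega),
            Store.bit_setArr_of_ne _ _ _ (by decide), h₄ v hv', Store.cnt_setArr, hv]
          by_cases hvl : v = l
          · subst hvl; simp [h]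
          · simp only [hvl, if_false, show v < l + 1 ↔ v < l by omega]
      · refine ⟨by simp [h₁], by simp [h₂], fun v hv' => ?_, fun v hv' => ?_⟩
        · rw [Store.bit_setCnt, Store.bit_setArr_set _ _ (by omega), hv]
          by_cases hvl : v = l
          · subst hvl; simp [h]
          · simp [hvl, h₃ v (by omega)]
        · rw [Store.bit_setCnt, Store.bit_setArr_of_ne _ _ _ (by decide), h₄ v hv']
          by_cases hvl : v = l
          · subst hvl; simp [h]
          · simp only [show v < l + 1 ↔ v < l by omega])
  rw [min_eq_left hn] at this
  refine ⟨this.1, this.2.1, this.2.2.1, fun v hv => ?_⟩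
  rw [update, this.2.2.2 v hv]
  simp [hv]

/-- The digraph on `n` vertices with a given adjacency matrix. -/
def _root_.Digraph.ofBits (l : List Bool) (n : ℕ) : Digraph (Fin n) where
  Adj u v := l.getD (u * n + v) false = true

/-- After `t` rounds `cur` is the set of ends of walks of length `t` from `r`, and `seen` the set of
ends of those of length 1 to `t`. The counter `t` holds only the residue modulo `k`, so that
divisibility is a comparison with 0. -/
theorem eval_checkVertex {n : ℕ} (hn : s.cnt .n = n) (hnN : n ≤ N) (hz : s.cnt .nought = 0)
    (r : Fin n) (hr : s.cnt .r = r) :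
    (checkVertex.eval N s).cnt .bad = 0 ↔ s.cnt .bad = 0 ∧
      (∀ v, ∃ t < N, (Digraph.ofBits (s.arr .bits) n).Walk (t + 1) r v) ∧
      ∀ t < N, (Digraph.ofBits (s.arr .bits) n).Walk (t + 1) r r → s.cnt .k ∣ t + 1 := by
  set D := Digraph.ofBits (s.arr .bits) n with hD
  set s₁ := (((s.setArr .cur (List.replicate N false)).setArr .cur
    ((List.replicate N false).set r true)).setArr .seen (List.replicate N false)).setCnt .t 0
    with hs₁
  have e₁ : checkVertex.eval N s = (forLt 1 .v .n (ifBit .seen .v skip (inc .bad)) :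
      Procedure).eval N ((loop 1 (seq image <| seq update <| seq (inc .t) <|
        seq (ifEq .t .k (zero .t) skip) <| ifBit .cur .r (ifEq .t .nought skip (inc .bad)) skip) :
          Procedure).eval N s₁) := by
    rw [checkVertex, eval, eval, eval, eval, eval, eval_alloc, eval_alloc, hs₁, ← hr]
    simp [eval]
  rw [e₁]
  have h₁ := eval_loop (N := N) (s := s₁) (body := (seq image <| seq update <| seq (inc .t) <|
        seq (ifEq .t .k (zero .t) skip) <| ifBit .cur .r (ifEq .t .nought skip (inc .bad)) skip :
          Procedure)) 1 (fun t s' => s'.cnt .t = t % s.cnt .k ∧ (s'.arr .cur).length = N ∧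
      (s'.arr .seen).length = N ∧ (∀ v : Fin n, s'.bit .cur v ↔ D.Walk t r v) ∧
      (∀ v : Fin n, s'.bit .seen v ↔ ∃ t' < t, D.Walk (t' + 1) r v) ∧
      (s'.cnt .bad = 0 ↔ s.cnt .bad = 0 ∧ ∀ t' < t, D.Walk (t' + 1) r r → s.cnt .k ∣ t' + 1)) (by
      refine ⟨by simp [hs₁], by simp [hs₁], by simp [hs₁], fun v => ?_, fun v => ?_, by simp [hs₁]⟩
      · rw [hs₁, Store.bit_setCnt, Store.bit_setArr_of_ne _ _ _ (by decide)]
        have := r.2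
        have h := Store.bit_setArr_set (s.setArr .cur (List.replicate N false)) (a := .cur)
          (i := r) (j := v) true (by simp; omega)
        simp only [Store.arr_setArr, if_true] at h
        rw [h]
        simp [not_bit_alloc, Digraph.Walk, Fin.ext_iff, eq_comm]
      · rw [hs₁, Store.bit_setCnt]
        simp [not_bit_alloc]) (by
      rintro t s' ht hf ⟨ht', hcur, hseen, hcur', hseen', hbad⟩
      have hn' : s'.cnt .n = n := by rw [hf.1 .n rfl]; simp [hs₁, hn]
      obtain ⟨-, h₂⟩ := eval_image (N := N) (s := s') (by omega)
      have f₂ := frame_eval image N s'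
      set s₂ := image.eval N s' with hs₂
      have hn₂ : s₂.cnt .n = n := (f₂.1 .n rfl).trans hn'
      obtain ⟨h₃, h₄, h₅, h₆⟩ := eval_update (N := N) (s := s₂) (by omega)
        ((congrArg _ (f₂.2 .cur rfl)).trans hcur) ((congrArg _ (f₂.2 .seen rfl)).trans hseen)
      have f₃ := frame_eval update N s₂
      set s₃ := update.eval N s₂ with hs₃
      rw [hn'] at h₂
      rw [hn₂] at h₅ h₆
      have hstep : ∀ v : Fin n, s₂.bit .next v ↔ D.Walk (t + 1) r v := by
        intro v
        rw [h₂ v v.2, Digraph.Walk]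
        have hbits : s'.arr .bits = s.arr .bits := by rw [hf.2 .bits rfl]; simp [hs₁]
        constructor
        · rintro ⟨u, hu, huc, hub⟩
          refine ⟨⟨u, hu⟩, (hcur' ⟨u, hu⟩).1 huc, ?_⟩
          rw [Store.bit, hbits] at hub
          exact hub
        · rintro ⟨u, hu, huv⟩
          refine ⟨u, u.2, (hcur' u).2 hu, ?_⟩
          rw [Store.bit, hbits]
          exact huv
      have hk : s₃.cnt .k = s.cnt .k := by
        rw [f₃.1 .k rfl, f₂.1 .k rfl, hf.1 .k rfl]; simp [hs₁]
      have hr₃ : s₃.cnt .r = r := by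
        rw [f₃.1 .r rfl, f₂.1 .r rfl, hf.1 .r rfl]; simp [hs₁, hr]
      have hz₃ : s₃.cnt .nought = 0 := by
        rw [f₃.1 .nought rfl, f₂.1 .nought rfl, hf.1 .nought rfl]; simp [hs₁, hz]
      have ht₃ : s₃.cnt .t = t % s.cnt .k := by
        rw [f₃.1 .t rfl, f₂.1 .t rfl, ht']
      have hb₃ : s₃.cnt .bad = s'.cnt .bad := by
        rw [f₃.1 .bad rfl, f₂.1 .bad rfl]
      set s₄ := s₃.setCnt .t ((t + 1) % s.cnt .k) with hs₄
      have e : (seq (inc .t) (ifEq .t .k (zero .t) skip) : Procedure).eval N s₃ = s₄ := by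
        simp only [eval, Store.cnt_setCnt, if_true, reduceCtorEq, if_false, hk, ht₃]
        -- The counter wraps around when it reaches `k`. For `k = 0` it never does, in agreement
        -- with the convention for the remainder modulo 0.
        have hmod : (t + 1) % s.cnt .k = if t % s.cnt .k + 1 = s.cnt .k then 0 else
            t % s.cnt .k + 1 := by
          rw [← Nat.mod_add_mod]
          split_ifs with h
          · rw [h, Nat.mod_self]
          · rcases Nat.eq_zero_or_pos (s.cnt .k) with h₀ | h₀
            · rw [h₀, Nat.mod_zero]
            · exact Nat.mod_eq_of_lt (by have := Nat.mod_lt t h₀; omega)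
        rw [hs₄, hmod]
        split_ifs <;> simp [Store.setCnt]
      have e' : (seq image <| seq update <| seq (inc .t) <|
        seq (ifEq .t .k (zero .t) skip) <| ifBit .cur .r (ifEq .t .nought skip (inc .bad)) skip :
          Procedure).eval N s' = (ifBit .cur .r (ifEq .t .nought skip (inc .bad)) skip :
          Procedure).eval N s₄ := by
        rw [← e]; rfl
      rw [e']
      have hc₄ : (s₄.arr .cur).getD (s₄.cnt .r) false = true ↔ D.Walk (t + 1) r r := by
        rw [← hstep r, ← h₅ r r.2, hs₄]
        simp [hr₃, Store.bit]
      have hd : s₄.cnt .t = s₄.cnt .nought ↔ s.cnt .k ∣ t + 1 := by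
        simp [hs₄, hz₃, Nat.dvd_iff_mod_eq_zero]
      have key : ∀ s₅ : Store Ctr Arr, s₅.cnt .t = s₄.cnt .t → s₅.arr = s₄.arr →
          (s₅.cnt .bad = 0 ↔ s'.cnt .bad = 0 ∧ (D.Walk (t + 1) r r → s.cnt .k ∣ t + 1)) →
          s₅.cnt .t = (t + 1) % s.cnt .k ∧ (s₅.arr .cur).length = N ∧
          (s₅.arr .seen).length = N ∧ (∀ v : Fin n, s₅.bit .cur v ↔ D.Walk (t + 1) r v) ∧
          (∀ v : Fin n, s₅.bit .seen v ↔ ∃ t' < t + 1, D.Walk (t' + 1) r v) ∧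
          (s₅.cnt .bad = 0 ↔
            s.cnt .bad = 0 ∧ ∀ t' < t + 1, D.Walk (t' + 1) r r → s.cnt .k ∣ t' + 1) := by
        intro s₅ h₇ h₈ h₉
        have hb : ∀ a i, s₅.bit a i ↔ s₃.bit a i := fun a i => by
          rw [Store.bit, h₈]; rfl
        refine ⟨by rw [h₇]; simp [hs₄], by rw [h₈]; exact h₃, by rw [h₈]; exact h₄, fun v => ?_,
          fun v => ?_, ?_⟩
        · rw [hb, h₅ v v.2, hstep]
        · rw [hb, h₆ v v.2, hstep, Nat.exists_lt_succ_right, ← hseen' v, Store.bit,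
            f₂.2 .seen rfl]
          rfl
        · rw [h₉, hbad, Nat.forall_lt_succ_right, and_assoc]
      classical
      simp only [eval, hc₄, hd]
      split_ifs with hw hdv
      · exact key _ rfl rfl (by simp [hs₄, hb₃, hdv])
      · exact key _ (by simp) rfl (by simp [hdv, hw])
      · exact key _ rfl rfl (by simp [hs₄, hb₃, hw]))
  set s₂ := (loop 1 (seq image <| seq update <| seq (inc .t) <|
        seq (ifEq .t .k (zero .t) skip) <| ifBit .cur .r (ifEq .t .nought skip (inc .bad)) skip) :
          Procedure).eval N s₁ with hs₂
  obtain ⟨-, -, -, -, hseen, hbad⟩ := h₁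
  have hn₂ : s₂.cnt .n = n := by
    rw [hs₂, (frame_eval _ N s₁).1 .n rfl]; simp [hs₁, hn]
  have h₂ := eval_forLt (N := N) (s := s₂) (body := (ifBit .seen .v skip (inc .bad) : Procedure)) 1
    (i := .v) (y := .n) (fun l s' => s'.cnt .bad = 0 ↔ s₂.cnt .bad = 0 ∧
      ∀ v : Fin n, (v : ℕ) < l → s₂.bit .seen v) (by decide) rfl rfl (by simp) (by
      intro l s' hl _ hv _ hf h
      have hs : (s'.arr .seen).getD (s'.cnt .v) false = true ↔ s₂.bit .seen l := by
        rw [hf.2 .seen rfl, hv]; rfl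
      rw [hn₂] at hl
      simp only [eval, hs]
      split_ifs with hb
      · simp only [Store.cnt_setCnt, reduceCtorEq, if_false, h]
        refine and_congr_right fun _ => ⟨fun H v hv => ?_, fun H v hv => H v (by omega)⟩
        rcases Nat.lt_succ_iff_lt_or_eq.1 hv with hv | hv
        · exact H v hv
        · rwa [hv]
      · simp only [Store.cnt_setCnt, reduceCtorEq, if_false, if_true]
        refine iff_of_false not_false fun H => hb (H.2 ⟨l, hl⟩ (by simp)))
  rw [hn₂, min_eq_left hnN] at h₂
  rw [h₂, hbad]
  simp only [Fin.is_lt, true_imp_iff, hseen]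
  tauto

theorem eval_checkDigraph {n : ℕ} (hn : s.cnt .n = n) (hnN : n ≤ N) (hz : s.cnt .nought = 0) :
    (checkDigraph.eval N s).cnt .bad = 0 ↔ s.cnt .bad = 0 ∧
      (Digraph.ofBits (s.arr .bits) n).WalkCondition N (s.cnt .k) := by
  set s₁ := (ifEq .n .nought (inc .bad) skip : Procedure).eval N s with hs₁
  have f₁ := frame_eval (ifEq .n .nought (inc .bad) skip : Procedure) N s
  rw [← hs₁] at f₁
  have hb : s₁.cnt .bad = 0 ↔ s.cnt .bad = 0 ∧ n ≠ 0 := by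
    simp only [hs₁, eval, hn, hz]
    split_ifs with h <;> simp [h]
  have hn₁ : s₁.cnt .n = n := (f₁.1 .n rfl).trans hn
  have := eval_forLt (N := N) (s := s₁) (body := checkVertex) 0 (i := .r) (y := .n)
    (fun j s' => s'.cnt .bad = 0 ↔ s₁.cnt .bad = 0 ∧ ∀ r : Fin n, (r : ℕ) < j →
      (∀ v, ∃ t < N, (Digraph.ofBits (s.arr .bits) n).Walk (t + 1) r v) ∧
      ∀ t < N, (Digraph.ofBits (s.arr .bits) n).Walk (t + 1) r r → s.cnt .k ∣ t + 1)
    (by decide) rfl rfl (by simp) (by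
      intro j s' hj _ hr hn' hf h
      rw [hn₁] at hj hn'
      have := eval_checkVertex (N := N) hn' hnN
        ((hf.1 .nought rfl).trans ((f₁.1 .nought rfl).trans hz)) ⟨j, hj⟩ hr
      rw [hf.2 .bits rfl, f₁.2 .bits rfl, hf.1 .k rfl, f₁.1 .k rfl, h] at this
      rw [Store.cnt_setCnt, if_neg (by decide), this, and_assoc]
      refine and_congr_right fun _ => ⟨fun H r hr => ?_, fun H => ⟨fun r hr => H r (by omega),
        H ⟨j, hj⟩ (by simp)⟩⟩
      rcases Nat.lt_succ_iff_lt_or_eq.1 hr with hr | hr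
      · exact H.1 r hr
      · rw [show r = ⟨j, hj⟩ from Fin.ext hr]
        exact H.2)
  rw [hn₁, min_eq_left hnN, hb] at this
  rw [checkDigraph, eval, ← hs₁, this, Digraph.WalkCondition]
  simp [and_assoc]

end PLCE

/-! ### Encodings -/

namespace Digraph

variable {n : ℕ}

theorem adjacencyBits_eq_ofFn (D : Digraph (Fin n)) [DecidableRel D.Adj] : D.adjacencyBits =
    List.ofFn fun i : Fin (n * n) => decide (D.Adj i.divNat i.modNat) := by
  rw [List.ofFn_mul, adjacencyBits, List.flatMap_def, List.ofFn_eq_map]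
  congr 1
  refine List.map_congr_left fun u _ => ?_
  rw [List.ofFn_eq_map]
  refine List.map_congr_left fun v _ => ?_
  have h₁ : (⟨u * n + v, by have := u.2; have := v.2; nlinarith⟩ : Fin (n * n)).divNat = u :=
    Fin.ext (by
      simp [Fin.divNat, Nat.add_div_of_dvd_right, Nat.mul_div_cancel _ (u.pos), Nat.div_eq_of_lt v.2])
  have h₂ : (⟨u * n + v, by have := u.2; have := v.2; nlinarith⟩ : Fin (n * n)).modNat = v :=
    Fin.ext (by simp [Fin.modNat, Nat.mod_eq_of_lt v.2])
  rw [h₁, h₂]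
  congr

theorem length_adjacencyBits (D : Digraph (Fin n)) : D.adjacencyBits.length = n * n := by
  classical
  simp [adjacencyBits_eq_ofFn]

/-- The tail `l` stands for the digits of `k`, which remain in the array behind the matrix and are
never read as arcs. -/
theorem ofBits_adjacencyBits_append (D : Digraph (Fin n)) (l : List Bool) :
    ofBits (D.adjacencyBits ++ l) n = D := by
  classical
  ext u v
  have h : (u : ℕ) * n + v < n * n := by have := u.2; have := v.2; nlinarith
  have h₁ : (⟨u * n + v, h⟩ : Fin (n * n)).divNat = u := Fin.ext (by
    simp [Fin.divNat, Nat.add_div_of_dvd_right, Nat.mul_div_cancel _ (u.pos), Nat.div_eq_of_lt v.2])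
  have h₂ : (⟨u * n + v, h⟩ : Fin (n * n)).modNat = v :=
    Fin.ext (by simp [Fin.modNat, Nat.mod_eq_of_lt v.2])
  change (D.adjacencyBits ++ l).getD (u * n + v) false = true ↔ _
  rw [List.getD_append _ _ _ _ (by rw [length_adjacencyBits]; exact h)]
  simp [adjacencyBits_eq_ofFn, List.getD_eq_getElem?_getD, h, h₁, h₂]

theorem adjacencyBits_ofBits {l : List Bool} (h : n * n ≤ l.length) :
    (ofBits l n).adjacencyBits = l.take (n * n) := by
  classical
  rw [adjacencyBits_eq_ofFn]
  refine List.ext_getElem (by simp [h]) fun i h₁ h₂ => ?_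
  rw [List.length_ofFn] at h₁
  rw [List.getElem_ofFn, List.getElem_take, Bool.eq_iff_iff, decide_eq_true_iff]
  change l.getD (i / n * n + i % n) false = true ↔ _
  rw [Nat.div_add_mod', List.getD_eq_getElem _ _ (by omega)]

theorem WalkCondition.le {N k : ℕ} {D : Digraph (Fin n)} (hN : n ≤ N) (hk : 2 ≤ k)
    (h : D.WalkCondition N k) : k ≤ n := by
  rw [walkCondition_iff hN hk, dvd_cyclicityIndex_iff hk] at h
  obtain ⟨-, ⟨m, hm⟩, h⟩ := h
  exact (Nat.le_of_dvd hm.1 (h m hm)).trans hm.le_card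

/-- The strongly connected conjunctive networks with limit cycles of length `k`, in terms of
interaction digraphs. -/
theorem exists_network_iff {N k : ℕ} {D : Digraph (Fin n)} (hN : n ≤ N) (hk : 2 ≤ k) :
    (∃ f : GlobalFunction n, f.IsConjunctive ∧ f.interactionDigraph.IsStronglyConnected ∧
      (f.limitCycleConfigs k).Nonempty ∧ f.interactionDigraph = D) ↔ D.WalkCondition N k := by
  rw [walkCondition_iff hN hk]
  constructor
  · rintro ⟨f, hf, hs, hne, rfl⟩
    exact ⟨hs, (hf.limitCycleConfigs_nonempty_iff hk hs).1 hne⟩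
  · rintro ⟨hs, hd⟩
    obtain ⟨f, hf, rfl⟩ := GlobalFunction.exists_isConjunctive D
    exact ⟨f, hf, hs, (hf.limitCycleConfigs_nonempty_iff hk hs).2 hd, rfl⟩

end Digraph

/-! ### Binary numerals. -/

/-- The number with a given list of binary digits, the least significant digit first. -/
def ofBinary : List Bool → ℕ
  | [] => 0
  | b :: l => 2 * ofBinary l + b.toNat

open Computability in
theorem ofBinary_encodePosNum (p : PosNum) : ofBinary (encodePosNum p) = p := by
  induction p with
  | one => rfl
  | bit0 p ih => simp [encodePosNum, ofBinary, ih, two_mul]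
  | bit1 p ih => simp [encodePosNum, ofBinary, ih, two_mul]

open Computability in
theorem ofBinary_encodeNat (k : ℕ) : ofBinary (encodeNat k) = k := by
  rw [encodeNat]
  conv_rhs => rw [← Num.to_of_nat k]
  cases (k : Num) with
  | zero => rfl
  | pos p => exact ofBinary_encodePosNum p

open Computability in
theorem getLast?_encodePosNum (p : PosNum) : (encodePosNum p).getLast? = some true := by
  induction p with
  | one => rfl
  | bit0 p ih | bit1 p ih => simp [encodePosNum, List.getLast?_cons, ih]

open Computability in
theorem exists_encodePosNum {l : List Bool} (h : l.getLast? = some true) :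
    ∃ p, encodePosNum p = l := by
  induction l with
  | nil => simp at h
  | cons b l ih =>
    rcases l with - | ⟨c, l⟩
    · simp at h
      exact ⟨.one, by simp [encodePosNum, h]⟩
    · obtain ⟨p, hp⟩ := ih (by simpa using h)
      cases b
      · exact ⟨.bit0 p, by rw [encodePosNum, hp]⟩
      · exact ⟨.bit1 p, by rw [encodePosNum, hp]⟩

open Computability in
-- A numeral of a positive number is precisely a word whose last, most significant, digit is 1. This
-- is the condition under which the digits in a word are a genuine encoding.
theorem encodeNat_ofBinary {l : List Bool} (h : l.getLast? = some true) :
    encodeNat (ofBinary l) = l := by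
  obtain ⟨p, rfl⟩ := exists_encodePosNum h
  rw [ofBinary_encodePosNum, encodeNat]
  rw [show ((p : ℕ) : Num) = Num.pos p from Num.of_to_nat (Num.pos p)]
  rfl

open Computability in
theorem getLast?_encodeNat {k : ℕ} (hk : k ≠ 0) : (encodeNat k).getLast? = some true := by
  have h := ofBinary_encodeNat k
  rw [encodeNat] at h ⊢
  cases hn : (k : Num) with
  | zero =>
    rw [hn] at h
    exact (hk h.symm).elim
  | pos p => exact getLast?_encodePosNum p

/-! ### The procedure for a fixed length of the limit cycles. -/

namespace PLCE

open Cmd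

variable {N : ℕ} {s : Store Ctr Arr}

theorem eval_squareRoot_checkDigraph (hm : s.cnt .m ≤ N) (hz : s.cnt .nought = 0) :
    ((seq squareRoot checkDigraph).eval N s).cnt .bad = 0 ↔ s.cnt .bad = 0 ∧
      ∃ n, n * n = s.cnt .m ∧ (Digraph.ofBits (s.arr .bits) n).WalkCondition N (s.cnt .k) := by
  obtain ⟨h₁, h₂, h₃⟩ := cnt_eval_squareRoot hm
  have f := frame_eval squareRoot N s
  rw [eval, eval_checkDigraph rfl h₁ ((f.1 .nought rfl).trans hz), h₃, f.2 .bits rfl, f.1 .k rfl,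
    and_assoc]
  refine and_congr_right fun _ => ⟨fun h => ⟨_, h⟩, ?_⟩
  rintro ⟨n, hn, h⟩
  have := h₂ ⟨n, hn⟩
  rw [← Nat.mul_self_inj.1 (hn.trans this.symm)]
  exact ⟨hn, h⟩

/-- Add `k` to the counter `k`. -/
def addConst : ℕ → Procedure
  | 0 => skip
  | k + 1 => seq (inc .k) (addConst k)

theorem eval_addConst (k : ℕ) : (addConst k).eval N s = s.setCnt .k (s.cnt .k + k) := by
  induction k generalizing s with
  | zero => simp [addConst, eval, Store.setCnt]
  | succ k ih =>
    rw [addConst, eval, ih]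
    simp [eval, Store.setCnt, add_assoc, add_comm 1 k]

theorem wellFormed_addConst (k : ℕ) : (addConst k).WellFormed := by
  induction k with
  | zero => trivial
  | succ k ih => exact ⟨trivial, ih⟩

theorem wellFormed_squareRoot_checkDigraph : (seq squareRoot checkDigraph).WellFormed := by
  simp [squareRoot, square, checkDigraph, checkVertex, image, update, alloc, forLt, WellFormed,
    loops]

theorem eval_loop_inc (d : Fin 4) (c : Ctr) :
    (loop d (inc c) : Procedure).eval N s = s.setCnt c (s.cnt c + N) :=
  eval_loop (s := s) (body := (inc c : Procedure)) d (fun i s' => s' = s.setCnt c (s.cnt c + i))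
    (by simp [Store.setCnt]) (by
      rintro i s' - - rfl
      simp [eval, Store.setCnt, add_assoc])

/-- The decision procedure for a fixed length of the limit cycles. -/
def decideFixed (k : ℕ) : Procedure :=
  seq (loop 0 (inc .m)) <| seq (addConst k) <| seq squareRoot checkDigraph

theorem mem_stronglyConnectedKPLCE {k : ℕ} (hk : 2 ≤ k) (w : List Bool) :
    w ∈ stronglyConnectedKPLCE k ↔
      ∃ n, n * n = w.length ∧ (Digraph.ofBits w n).WalkCondition w.length k := by
  constructor
  · rintro ⟨n, f, hf, hs, hne, rfl⟩
    refine ⟨n, (Digraph.length_adjacencyBits _).symm, ?_⟩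
    have := Digraph.ofBits_adjacencyBits_append f.interactionDigraph []
    rw [List.append_nil] at this
    rw [this, ← Digraph.exists_network_iff _ hk]
    · exact ⟨f, hf, hs, hne, rfl⟩
    · rw [Digraph.length_adjacencyBits]
      exact Nat.le_mul_self n
  · rintro ⟨n, hn, h⟩
    rw [← Digraph.exists_network_iff (by rw [← hn]; exact Nat.le_mul_self n) hk] at h
    obtain ⟨f, hf, hs, hne, h⟩ := h
    refine ⟨n, f, hf, hs, hne, ?_⟩
    rw [h, Digraph.adjacencyBits_ofBits hn.le, hn, List.take_length]

theorem inP_stronglyConnectedKPLCE {k : ℕ} (hk : 2 ≤ k) : InP (stronglyConnectedKPLCE k) := by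
  refine inP_of_eval (T := Fin 4) id id (a₁ := Arr.bits) (a₂ := .tags) (by decide) Ctr.bad
    (decideFixed k) ⟨⟨by simp [loops], trivial⟩, wellFormed_addConst k,
      wellFormed_squareRoot_checkDigraph⟩ fun w => ?_
  rw [mem_stronglyConnectedKPLCE hk]
  set s : Store Ctr Arr := ⟨fun _ => 0, fun a => if a = .bits then w.map id else
    if a = .tags then w.map id else []⟩ with hs
  rw [decideFixed, eval, eval_loop_inc, eval, eval_addConst, eval_squareRoot_checkDigraph (by simp [hs])
    (by simp [hs])]
  simp [hs]

/-! ### Lengths of limit cycles that are part of the input -/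

/-- Reject if a symbol with tag `false` follows one with tag `true`, and count the symbols with tag
`false`. -/
def parse : Procedure :=
  loop 0 (seq (ifBit .tags .i (inc .flag) (ifEq .flag .nought (inc .m) (inc .bad))) (inc .i))

/-- Double the counter `k`, up to the length of the input. -/
def double : Procedure :=
  seq (zero .q) <| seq (forLt 1 .u .k (seq (inc .q) (inc .q))) <| seq (zero .k) (forLt 1 .u .q (inc .k))

/-- Read the number whose binary digits are the bits with tag `true`. -/
def decode : Procedure :=
  loop 0 (seq (dec .i) (ifBit .tags .i (seq double (ifBit .bits .i (inc .k) skip)) skip))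

/-- Reject if the counter `k` is `0` or `1`, or if the last bit is `false`. -/
def checkNumber : Procedure :=
  seq (ifEq .k .nought (inc .bad) skip) <| seq (zero .q) <| seq (inc .q) <|
    seq (ifEq .k .q (inc .bad) skip) <| seq (zero .i) <| seq (loop 0 (inc .i)) <| seq (dec .i) <|
    ifBit .bits .i skip (inc .bad)

/-- The decision procedure for lengths of limit cycles that are part of the input. -/
def decideInput : Procedure :=
  seq parse <| seq decode <| seq checkNumber <| seq squareRoot checkDigraph

/-- While `bad` is 0, `m` is the position of the first tag `true`, and `flag` tells whether one has
occurred. Once `bad` is positive, a pair of tags in the wrong order witnesses that no threshold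
exists. -/
theorem eval_parse (h₀ : s.cnt = fun _ => 0) :
    (parse.eval N s).cnt .i = N ∧ (parse.eval N s).cnt .m ≤ N ∧
    ((parse.eval N s).cnt .bad = 0 ↔ ∃ m ≤ N, ∀ i < N, s.bit .tags i ↔ m ≤ i) ∧
    ((parse.eval N s).cnt .bad = 0 → ∀ i < N, s.bit .tags i ↔ (parse.eval N s).cnt .m ≤ i) := by
  have := eval_loop (N := N) (s := s) (body := (seq (ifBit .tags .i (inc .flag) (ifEq .flag .nought
    (inc .m) (inc .bad))) (inc .i) : Procedure)) 0 (fun l s' => s'.cnt .i = l ∧ s'.cnt .m ≤ l ∧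
      (s'.cnt .bad = 0 → (∀ i < l, s.bit .tags i ↔ s'.cnt .m ≤ i) ∧
        (s'.cnt .flag = 0 ↔ s'.cnt .m = l)) ∧
      (s'.cnt .bad ≠ 0 → ∃ i j, i < j ∧ j < l ∧ s.bit .tags i ∧ ¬ s.bit .tags j))
    (by simp [h₀]) (by
      rintro l s' hl hf ⟨h₁, h₂, h₃, h₄⟩
      have ht : (s'.arr .tags).getD (s'.cnt .i) false = true ↔ s.bit .tags l := by
        rw [hf.2 .tags rfl, h₁]; rfl
      have hz : s'.cnt .nought = 0 := by rw [hf.1 .nought rfl, h₀]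
      simp only [eval, ht, hz]
      split_ifs with ht' hfl
      · refine ⟨by simp [h₁], by simp; omega, ?_, ?_⟩
        · simp only [Store.cnt_setCnt, reduceCtorEq, if_false, if_true]
          intro hb
          obtain ⟨h₅, h₆⟩ := h₃ hb
          refine ⟨fun i hi => ?_, ⟨False.elim, fun h => by omega⟩⟩
          rcases Nat.lt_succ_iff_lt_or_eq.1 hi with hi | rfl
          · exact h₅ i hi
          · exact iff_of_true ht' h₂
        · simp only [Store.cnt_setCnt, reduceCtorEq, if_false]
          intro hb
          obtain ⟨i, j, hij, hj, h⟩ := h₄ hb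
          exact ⟨i, j, hij, by omega, h⟩
      · refine ⟨by simp [h₁], by simp [h₂], ?_, ?_⟩
        · simp only [Store.cnt_setCnt, reduceCtorEq, if_false, if_true]
          intro hb
          obtain ⟨h₅, h₆⟩ := h₃ hb
          have hm := h₆.1 hfl
          refine ⟨fun i hi => ?_, by omega⟩
          rcases Nat.lt_succ_iff_lt_or_eq.1 hi with hi | rfl
          · rw [h₅ i hi]; omega
          · exact iff_of_false ht' (by omega)
        · simp only [Store.cnt_setCnt, reduceCtorEq, if_false]
          intro hb
          obtain ⟨i, j, hij, hj, h⟩ := h₄ hb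
          exact ⟨i, j, hij, by omega, h⟩
      · refine ⟨by simp [h₁], by simp; omega, by simp, fun _ => ?_⟩
        by_cases hb : s'.cnt .bad = 0
        · obtain ⟨h₅, h₆⟩ := h₃ hb
          have hlt : s'.cnt .m < l := lt_of_le_of_ne h₂ fun h => hfl (h₆.2 h)
          exact ⟨s'.cnt .m, l, hlt, by omega, (h₅ _ hlt).2 le_rfl, ht'⟩
        · obtain ⟨i, j, hij, hj, h⟩ := h₄ hb
          exact ⟨i, j, hij, by omega, h⟩)
  change _ ∧ (parse.eval N s).cnt .m ≤ N ∧ _ at this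
  obtain ⟨h₁, h₂, h₃, h₄⟩ := this
  refine ⟨h₁, h₂, ⟨fun hb => ⟨_, h₂, (h₃ hb).1⟩, ?_⟩, fun hb => (h₃ hb).1⟩
  rintro ⟨m, -, hm⟩
  by_contra hb
  obtain ⟨i, j, hij, hj, hi, hj'⟩ := h₄ hb
  rw [hm i (by omega)] at hi
  rw [hm j hj] at hj'
  omega

/-- Each of the two loops is cut off after `N` rounds, whence the two minima. -/
theorem cnt_eval_double : (double.eval N s).cnt .k = min (2 * min (s.cnt .k) N) N := by
  have h₁ := eval_forLt (N := N) (s := s.setCnt .q 0) (body := (seq (inc .q) (inc .q) : Procedure))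
    1 (i := .u) (y := .k) (fun j s' => s'.cnt .q = 2 * j) (by decide) rfl rfl (by simp) (by
      intro j s' _ _ _ _ _ h
      simp [eval, h, mul_add])
  set s₁ := (forLt 1 .u .k (seq (inc .q) (inc .q)) : Procedure).eval N (s.setCnt .q 0)
  have h₂ := eval_forLt (N := N) (s := s₁.setCnt .k 0) (body := (inc .k : Procedure))
    1 (i := .u) (y := .q) (fun j s' => s'.cnt .k = j) (by decide) rfl rfl (by simp) (by
      intro j s' _ _ _ _ _ h
      simp [eval, h])
  simp only [Store.cnt_setCnt, reduceCtorEq, if_false] at h₁ h₂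
  rw [h₁] at h₂
  exact h₂

/-- Horner's scheme from the last, most significant, digit down to position `m`. An exact value may
be exponential in `N`; the doubling saturates at `N` instead, and from then on the counter and the
true value both stay at least `N`. -/
theorem eval_decode (hi : s.cnt .i = N) (hk : s.cnt .k = 0) (hl : (s.arr .bits).length = N)
    {m : ℕ} (hm : m ≤ N) (ht : ∀ i < N, s.bit .tags i ↔ m ≤ i) :
    (decode.eval N s).cnt .k = ofBinary ((s.arr .bits).drop m) ∨
      N ≤ (decode.eval N s).cnt .k ∧ N ≤ ofBinary ((s.arr .bits).drop m) := by
  have := eval_loop (N := N) (s := s) (body := (seq (dec .i) (ifBit .tags .i (seq double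
    (ifBit .bits .i (inc .k) skip)) skip) : Procedure)) 0 (fun l s' => s'.cnt .i = N - l ∧
      (s'.cnt .k = ofBinary ((s.arr .bits).drop (max m (N - l))) ∨
      N ≤ s'.cnt .k ∧ N ≤ ofBinary ((s.arr .bits).drop (max m (N - l)))))
    (by
      refine ⟨by simpa using hi, .inl ?_⟩
      rw [hk, List.drop_eq_nil_of_le (by omega)]
      rfl) (by
      rintro l s' hl' hf ⟨h₁, h₂⟩
      obtain ⟨j, hj⟩ : ∃ j, N - l = j + 1 := ⟨N - l - 1, by omega⟩
      have hj' : N - (l + 1) = j := by omega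
      rw [hj] at h₁ h₂
      rw [hj']
      set s₁ := (dec .i : Procedure).eval N s' with hs₁
      have hi₁ : s₁.cnt .i = j := by simp [hs₁, eval, h₁]
      have hk₁ : s₁.cnt .k = s'.cnt .k := by simp [hs₁, eval]
      have ht₁ : (s₁.arr .tags).getD (s₁.cnt .i) false = true ↔ m ≤ j := by
        rw [hi₁, ← ht j (by omega), Store.bit, ← hf.2 .tags rfl]
        rfl
      have hl₁ : j < (s.arr .bits).length := by omega
      have hk₂ : (double.eval N s₁).cnt .k = min (2 * min (s'.cnt .k) N) N := by
        rw [cnt_eval_double, hk₁]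
      have hi₂ : (double.eval N s₁).cnt .i = j := ((frame_eval double N s₁).1 .i rfl).trans hi₁
      have hb₂ : ((double.eval N s₁).arr .bits).getD ((double.eval N s₁).cnt .i) false =
          (s.arr .bits)[j] := by
        rw [hi₂, (frame_eval double N s₁).2 .bits rfl, hs₁, ← List.getD_eq_getElem _ false hl₁,
          ← hf.2 .bits rfl]
        rfl
      rw [eval, ← hs₁]
      simp only [eval, ht₁, hb₂]
      split_ifs with hmj hb
      · rw [max_eq_right (by omega)] at h₂ ⊢
        rw [List.drop_eq_getElem_cons hl₁, ofBinary, hb]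
        refine ⟨by simpa using hi₂, ?_⟩
        simp only [Store.cnt_setCnt, if_true, hk₂, Bool.toNat_true]
        omega
      · rw [max_eq_right (by omega)] at h₂ ⊢
        rw [List.drop_eq_getElem_cons hl₁, ofBinary, Bool.eq_false_of_not_eq_true hb]
        refine ⟨hi₂, ?_⟩
        simp only [hk₂, Bool.toNat_false]
        omega
      · refine ⟨hi₁, ?_⟩
        rw [hk₁]
        rwa [show max m j = max m (j + 1) by omega])
  have h := this.2
  rw [Nat.sub_self, max_eq_left (Nat.zero_le m)] at h
  exact h

end PLCE

namespace PLCE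

open Cmd

variable {N : ℕ} {s : Store Ctr Arr}

theorem eval_checkNumber (hz : s.cnt .nought = 0) :
    (checkNumber.eval N s).cnt .bad = 0 ↔
      s.cnt .bad = 0 ∧ 2 ≤ s.cnt .k ∧ s.bit .bits (N - 1) := by
  have hL : ∀ s : Store Ctr Arr, (loop 0 (inc .i) : Procedure).eval N s =
      s.setCnt .i (s.cnt .i + N) := fun s => eval_loop_inc 0 .i
  rw [checkNumber]
  generalize (loop 0 (inc .i) : Procedure) = L at hL ⊢
  simp only [eval, hL, hz, Store.bit]
  by_cases h₀ : s.cnt .k = 0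
  · split_ifs <;> simp_all
  by_cases h₁ : s.cnt .k = 1
  · split_ifs <;> simp_all
  have h₂ : 2 ≤ s.cnt .k := by omega
  split_ifs <;> simp_all

/-- As `k` divides the length of a cycle, `2 ≤ k ≤ n < n * n ≤ N`. A saturated value of `k`
therefore always belongs to a negative instance. -/
theorem _root_.Digraph.WalkCondition.not_le {n N k : ℕ} {D : Digraph (Fin n)} (hN : n * n ≤ N)
    (hk : 2 ≤ k) (h : D.WalkCondition N k) : ¬ N ≤ k := by
  intro h'
  have := h.le ((Nat.le_mul_self n).trans hN) hk
  nlinarith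

theorem eval_decideInput (hc : s.cnt = fun _ => 0) (hl : (s.arr .bits).length = N) :
    (decideInput.eval N s).cnt .bad = 0 ↔ ∃ m ≤ N, (∀ i < N, s.bit .tags i ↔ m ≤ i) ∧
      2 ≤ ofBinary ((s.arr .bits).drop m) ∧ s.bit .bits (N - 1) ∧
        ∃ n, n * n = m ∧ (Digraph.ofBits (s.arr .bits) n).WalkCondition N
          (ofBinary ((s.arr .bits).drop m)) := by
  obtain ⟨hi, hm, h₁, h₂⟩ := eval_parse (N := N) hc
  have f₁ := frame_eval parse N s
  set s₁ := parse.eval N s with hs₁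
  have hb₁ : s₁.arr .bits = s.arr .bits := f₁.2 .bits rfl
  have ht₁ : ∀ i, s₁.bit .tags i ↔ s.bit .tags i := fun i => by rw [Store.bit, f₁.2 .tags rfl]; rfl
  have hk₁ : s₁.cnt .k = 0 := by rw [f₁.1 .k rfl, hc]
  have f₂ := frame_eval decode N s₁
  have h₃ := eval_decode (N := N) (s := s₁) hi hk₁ (by rw [hb₁, hl]) hm
  set s₂ := decode.eval N s₁ with hs₂
  have hb₂ : s₂.arr .bits = s.arr .bits := (f₂.2 .bits rfl).trans hb₁
  have hz₂ : s₂.cnt .nought = 0 := by rw [f₂.1 .nought rfl, f₁.1 .nought rfl, hc]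
  have f₃ := frame_eval checkNumber N s₂
  have h₄ := eval_checkNumber (N := N) hz₂
  set s₃ := checkNumber.eval N s₂ with hs₃
  have hm₃ : s₃.cnt .m = s₁.cnt .m := (f₃.1 .m rfl).trans (f₂.1 .m rfl)
  rw [decideInput, eval, eval, eval, ← hs₁, ← hs₂, ← hs₃, eval_squareRoot_checkDigraph
    (by rw [hm₃]; exact hm) ((f₃.1 .nought rfl).trans hz₂), h₄, f₂.1 .bad rfl, h₁, hm₃,
    f₃.1 .k rfl, f₃.2 .bits rfl, hb₂, Store.bit, hb₂]
  have key : s₁.cnt .bad = 0 → ((2 ≤ s₂.cnt .k ∧ s.bit .bits (N - 1) ∧ ∃ n, n * n = s₁.cnt .m ∧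
      (Digraph.ofBits (s.arr .bits) n).WalkCondition N (s₂.cnt .k)) ↔
      2 ≤ ofBinary ((s.arr .bits).drop (s₁.cnt .m)) ∧ s.bit .bits (N - 1) ∧
        ∃ n, n * n = s₁.cnt .m ∧ (Digraph.ofBits (s.arr .bits) n).WalkCondition N
          (ofBinary ((s.arr .bits).drop (s₁.cnt .m)))) := by
    intro hb
    have h := h₃ fun i hi => (ht₁ i).trans (h₂ hb i hi)
    rw [hb₁] at h
    rcases h with h | ⟨h, h'⟩
    · rw [h]
    -- In the saturated case the counter may differ from the true number, but both are at least `N`,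
    -- so the condition fails for both.
    · refine iff_of_false ?_ ?_
      · rintro ⟨hk, -, n, hn, H⟩
        exact H.not_le (hn.trans_le hm) hk h
      · rintro ⟨hk, -, n, hn, H⟩
        exact H.not_le (hn.trans_le hm) hk h'
  constructor
  · rintro ⟨⟨h, hk, hb⟩, hn⟩
    have hbad := h₁.2 h
    exact ⟨s₁.cnt .m, hm, h₂ hbad, (key hbad).1 ⟨hk, hb, hn⟩⟩
  · rintro ⟨m, hmN, ht, h⟩
    have hbad := h₁.2 ⟨m, hmN, ht⟩
    -- Two thresholds for the same tags coincide, as the smaller one is otherwise a position below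
    -- `N` where they disagree.
    obtain rfl : m = s₁.cnt .m := by
      have h₅ := h₂ hbad
      by_contra hne
      rcases lt_or_gt_of_ne hne with hlt | hlt
      · have h₆ := (ht m (by omega)).symm.trans (h₅ m (by omega))
        omega
      · have h₆ := (ht _ (by omega)).symm.trans (h₅ (s₁.cnt .m) (by omega))
        omega
    obtain ⟨hk, hb, hn⟩ := (key hbad).2 h
    exact ⟨⟨⟨_, hmN, ht⟩, hk, hb⟩, hn⟩

theorem eq_map_inl_append_map_inr {w : List (Bool ⊕ Bool)} {m : ℕ}
    (ht : ∀ i < w.length, (w.map Sum.isRight).getD i false = true ↔ m ≤ i) :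
    w = ((w.map (Sum.elim id id)).take m).map Sum.inl ++
      ((w.map (Sum.elim id id)).drop m).map Sum.inr := by
  refine List.ext_getElem (by simp; omega) fun i h₁ h₂ => ?_
  have h := ht i h₁
  rw [List.getD_eq_getElem _ _ (by simpa using h₁), List.getElem_map] at h
  rw [List.getElem_append]
  split_ifs with hi
  · have : ¬ m ≤ i := by simp at hi; omega
    rw [← h] at this
    cases hw : w[i] <;> simp_all
  · have hmi : m ≤ i := by simp at hi; omega
    have hmin : min m w.length = m := by omega
    simp only [List.getElem_map, List.getElem_drop, List.length_map, List.length_take, hmin,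
      Nat.add_sub_cancel' hmi]
    rw [← h] at hmi
    cases hw : w[i] <;> simp_all

theorem mem_stronglyConnectedPLCE (w : List (Bool ⊕ Bool)) : w ∈ stronglyConnectedPLCE ↔
    ∃ m ≤ w.length, (∀ i < w.length, (w.map Sum.isRight).getD i false = true ↔ m ≤ i) ∧
      2 ≤ ofBinary ((w.map (Sum.elim id id)).drop m) ∧
      (w.map (Sum.elim id id)).getD (w.length - 1) false = true ∧
      ∃ n, n * n = m ∧ (Digraph.ofBits (w.map (Sum.elim id id)) n).WalkCondition w.length
        (ofBinary ((w.map (Sum.elim id id)).drop m)) := by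
  constructor
  · rintro ⟨n, k, f, hk, hf, hs, hne, rfl⟩
    have hw : (encodePLCE f k).map (Sum.elim id id) =
        f.interactionDigraph.adjacencyBits ++ Computability.encodeNat k := by
      simp [encodePLCE]
    have hlen : (encodePLCE f k).length = n * n + (Computability.encodeNat k).length := by
      simp [encodePLCE, Digraph.length_adjacencyBits]
    have hdrop : ((encodePLCE f k).map (Sum.elim id id)).drop (n * n) =
        Computability.encodeNat k := by
      rw [hw, ← Digraph.length_adjacencyBits f.interactionDigraph, List.drop_left]
    refine ⟨n * n, by omega, fun i hi => ?_, ?_, ?_, n, rfl, ?_⟩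
    · rw [List.getD_eq_getElem _ _ (by simpa using hi)]
      simp only [encodePLCE, List.map_append, List.map_map, List.getElem_append, List.length_map,
        Digraph.length_adjacencyBits]
      split_ifs with h
      · simpa using h
      · simpa using h
    · rw [hdrop, ofBinary_encodeNat]
      exact hk
    · have h := getLast?_encodeNat (k := k) (by omega)
      rw [show (encodePLCE f k).length = ((encodePLCE f k).map (Sum.elim id id)).length by simp,
        hw, List.getD_eq_getElem?_getD, ← List.getLast?_eq_getElem?, List.getLast?_append, h]
      rfl
    · rw [hdrop, hw, Digraph.ofBits_adjacencyBits_append, ofBinary_encodeNat,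
        ← Digraph.exists_network_iff ((Nat.le_mul_self n).trans (by omega)) hk]
      exact ⟨f, hf, hs, hne, rfl⟩
  · rintro ⟨_, hm, ht, hk, hb, n, rfl, h⟩
    set l := w.map (Sum.elim id id) with hl
    have hlen : l.length = w.length := by simp [hl]
    rw [← Digraph.exists_network_iff ((Nat.le_mul_self n).trans hm) hk] at h
    obtain ⟨f, hf, hs, hne, h⟩ := h
    refine ⟨n, _, f, hk, hf, hs, hne, ?_⟩
    -- There is at least one digit, since the empty numeral has value 0, less than 2. So the last
    -- bit of the word is the most significant digit of `k`.
    have hdrop : (l.drop (n * n)).getLast? = some true := by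
      have hlt : n * n < l.length := by
        by_contra hle
        rw [List.drop_eq_nil_of_le (by omega)] at hk
        simp [ofBinary] at hk
      rw [← hlen, List.getD_eq_getElem _ _ (by omega)] at hb
      rw [List.getLast?_drop, if_neg (by omega), List.getLast?_eq_getElem?,
        List.getElem?_eq_getElem (by omega), hb]
    rw [encodePLCE, h, Digraph.adjacencyBits_ofBits (by omega), encodeNat_ofBinary hdrop]
    exact eq_map_inl_append_map_inr ht

theorem wellFormed_decideInput : decideInput.WellFormed := by
  simp [decideInput, parse, decode, double, checkNumber, squareRoot, square, checkDigraph,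
    checkVertex, image, update, alloc, forLt, WellFormed, loops]

theorem inP_stronglyConnectedPLCE : InP stronglyConnectedPLCE := by
  refine inP_of_eval (T := Fin 4) (Sum.elim id id) Sum.isRight (a₁ := Arr.bits) (a₂ := .tags)
    (by decide) Ctr.bad decideInput wellFormed_decideInput fun w => ?_
  rw [mem_stronglyConnectedPLCE, eval_decideInput rfl (by simp)]
  simp only [Store.bit, if_true, reduceCtorEq, if_false]

end PLCE

theorem mainTheorem3 :
    InP stronglyConnectedPLCE ∧
    (∀ k : ℕ, 2 ≤ k → InP (stronglyConnectedKPLCE k)) ∧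
    (∀ (n k : ℕ) (f : GlobalFunction n), 2 ≤ k → f.IsConjunctive →
      f.interactionDigraph.IsStronglyConnected →
      ((f.limitCycleConfigs k).Nonempty ↔ k ∣ f.interactionDigraph.cyclicityIndex)) :=
  ⟨PLCE.inP_stronglyConnectedPLCE, fun _ hk => PLCE.inP_stronglyConnectedKPLCE hk,
    fun _ _ _ hk hf hs => hf.limitCycleConfigs_nonempty_iff hk hs⟩
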